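/- Let $\rho\in\mathbb R$ and let $\mathbb M^3(\rho)$ be the 3-space form of curvature $\rho$, i.e. $\mathbb R^3$ if $\rho=0$, the round sphere $\{\langle x,x\rangle=1/\rho\}\subset\mathbb R^4$ if $\rho>0$, and the hyperbolic space $\{\langle x,x\rangle=1/\rho,\ x_4>0\}$ in Minkowski space $\mathbb R^4_1$ if $\rho<0$. A one-parameter group of rotations is a non-trivial one-parameter group $\{\phi_t\}_{t\in\mathbb R}$ of isometries of $\mathbb M^3(\rho)$ which fixes pointwise a straight line if $\rho=0$, and which is the restriction of linear isometries fixing pointwise a 2-dimensional linear subspace of $\mathbb R^4$ if $\rho\neq0$ (for $\rho<0$ this includes the spherical, hyperbolic and parabolic rotations). A rotational surface is a smoothly immersed surface $N^2\subset\mathbb M^3(\rho)$ that is invariant under such a group (the group acts smoothly on $N^2$ and the immersion is equivariant). A profile curve of $N^2$ is a smooth curve $\gamma$ in $N^2$, defined on an open interval $I$ and parametrized by arc length $s$, that is orthogonal to the orbits of the group. The surface is isoparametric if both its principal curvatures $\kappa_1,\kappa_2$ are constant, and its skew curvature is $\mathcal S_k=2\sqrt{H^2-K+\rho}=|\kappa_1-\kappa_2|$,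 where $H=(\kappa_1+\kappa_2)/2$ and $K=\kappa_1\kappa_2+\rho$. **Theorem.** Let $N^2\subset\mathbb M^3(\rho)$ be a non-isoparametric rotational surface with constant skew curvature $\mathcal S_k=c>0$, and let $\gamma:I\to N^2$ be a profile curve of $N^2$. Then $\gamma$ lies in a totally geodesic surface $\mathbb M^2(\rho)$ of $\mathbb M^3(\rho)$, and for a suitable one of the two orientations of $\gamma$ in $\mathbb M^2(\rho)$ (that is, choices of a smooth unit normal field $\nu$ of $\gamma$ in $\mathbb M^2(\rho)$) the following holds. Let $\kappa=\langle\widetilde\nabla_{\gamma'}\gamma',\nu\rangle$ be the signed curvature of $\gamma$. Then along $\gamma$ the vector $-\nu$ is a unit normal of $N^2$, with respect to which the principal curvatures of $N^2$ are $\kappa_1=-\kappa$ and $\kappa_2=\kappa_1-c$, and $\kappa$ satisfies on $I$ the Euler–Lagrange equation of the exponential curvature energy $\mathbf\Theta_\mu(\gamma)=\int_\gamma e^{\mu\kappa}\,ds$ on curves in $\mathbb M^2(\rho)$ with $\mu=-1/c$, namely $$\frac{d^2}{ds^2}\left(e^{\mu\kappa}\right)+\left(\kappa^2-\frac{\kappa}{\mu}+\rho\right)e^{\mu\kappa}=0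 .$$ -/

import Mathlib

open scoped Manifold ContDiff

noncomputable section

namespace SkewRot

/-- The ambient linear space of the models of the 3-space forms. -/
abbrev V4 : Type := Fin 4 → ℝ

/-- The ambient metric: Euclidean on `ℝ⁴` if `0 ≤ ρ`, Lorentzian (signature `+ + + -`) if `ρ < 0`. -/
def form (ρ : ℝ) (x y : V4) : ℝ :=
  x 0 * y 0 + x 1 * y 1 + x 2 * y 2 + (if ρ < 0 then -1 else 1) * (x 3 * y 3)

/-- The 3-space form of curvature `ρ`, with the metric induced by `form ρ`: the hyperplane
`x₃ = 0` if `ρ = 0`, the sphere `⟨x, x⟩ = 1/ρ` if `ρ > 0`, and the upper sheet `x₃ > 0` of the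
hyperboloid `⟨x, x⟩ = 1/ρ` if `ρ < 0`. -/
def spaceForm (ρ : ℝ) : Set V4 :=
  {x | (ρ = 0 → x 3 = 0) ∧ (ρ ≠ 0 → form ρ x x = 1 / ρ) ∧ (ρ < 0 → 0 < x 3)}

/-- `v` is tangent to the space form at its point `x`. -/
def IsTangent (ρ : ℝ) (x v : V4) : Prop :=
  (ρ = 0 → v 3 = 0) ∧ (ρ ≠ 0 → form ρ x v = 0)

/-- `(n, d)` describes a totally geodesic surface of the space form: `n` is a unit vector and the
surface is cut out by `⟨n, x⟩ = d`. If `ρ = 0` this is an arbitrary affine plane of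
`ℝ³ = {x₃ = 0}`; if `ρ ≠ 0` the hyperplane has to pass through the origin. -/
def IsGeodesicSurfaceData (ρ : ℝ) (n : V4) (d : ℝ) : Prop :=
  form ρ n n = 1 ∧ (ρ = 0 → n 3 = 0) ∧ (ρ ≠ 0 → d = 0)

/-- The totally geodesic surface with data `(n, d)`, a copy of the 2-space form of curvature `ρ`. -/
def geodesicSurface (ρ : ℝ) (n : V4) (d : ℝ) : Set V4 :=
  {x | x ∈ spaceForm ρ ∧ form ρ n x = d}

/-- `φ` is a one-parameter group of rotations of the space form. Its elements are isometries, given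
as restrictions of affine maps of `ℝ⁴` (linear ones if `ρ ≠ 0`) which preserve the metric and the
model. If `ρ = 0` the group fixes a straight line of `ℝ³` pointwise. If `ρ ≠ 0` it fixes a
2-dimensional linear subspace `W` of `ℝ⁴` pointwise. For `ρ > 0` the axis is the geodesic in which
`W` meets the sphere. For `ρ < 0` the rotations are spherical, hyperbolic or parabolic according to
whether `W` is Lorentzian (its intersection with the model is then the axis), spacelike or
degenerate. -/
structure IsRotationGroup (ρ : ℝ) (φ : ℝ → V4 →ᵃ[ℝ] V4) : Prop where
  map_zero : ∀ x, φ 0 x = x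
  map_add : ∀ s t x, φ (s + t) x = φ s (φ t x)
  smooth : ∀ x, ContDiff ℝ ∞ (fun t => φ t x)
  preserves_model : ∀ t, ∀ x ∈ spaceForm ρ, φ t x ∈ spaceForm ρ
  preserves_form : ∀ t v w, form ρ ((φ t).linear v) ((φ t).linear w) = form ρ v w
  linear_of_ne : ρ ≠ 0 → ∀ t, φ t 0 = 0
  nontrivial : ∃ t, ∃ x ∈ spaceForm ρ, φ t x ≠ x
  fixes_line : ρ = 0 → ∃ p v : V4, p 3 = 0 ∧ v 3 = 0 ∧ v ≠ 0 ∧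
    ∀ t a : ℝ, φ t (p + a • v) = p + a • v
  fixes_plane : ρ ≠ 0 → ∃ W : Submodule ℝ V4, Module.finrank ℝ W = 2 ∧
    ∀ t : ℝ, ∀ x ∈ W, φ t x = x

/-- The Killing vector field generating `φ`; at `x` it is tangent to the orbit of `x`. -/
def killing (φ : ℝ → V4 →ᵃ[ℝ] V4) (x : V4) : V4 := deriv (fun t => φ t x) 0

section Surfaces

variable {N : Type*} [TopologicalSpace N] [ChartedSpace (EuclideanSpace ℝ (Fin 2)) N]

/-- `Φ` is a smooth immersion of the surface `N` in the space form. The surface `N` carries the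
metric induced by `Φ`. -/
structure IsImmersedSurface (ρ : ℝ) (Φ : N → V4) : Prop where
  smooth : ContMDiff (𝓡 2) 𝓘(ℝ, V4) ∞ Φ
  mem : ∀ p, Φ p ∈ spaceForm ρ
  immersion : ∀ p, Function.Injective (mfderiv (𝓡 2) 𝓘(ℝ, V4) Φ p)

/-- The immersed surface is invariant under the group `φ`: the group acts smoothly on `N` and `Φ`
is equivariant. -/
def IsInvariantUnder (Φ : N → V4) (φ : ℝ → V4 →ᵃ[ℝ] V4) : Prop :=
  ∃ τ : ℝ → N → N, (∀ p, τ 0 p = p) ∧ (∀ s t p, τ (s + t) p = τ s (τ t p)) ∧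
    ContMDiff (𝓘(ℝ, ℝ).prod (𝓡 2)) (𝓡 2) ∞ (fun q : ℝ × N => τ q.1 q.2) ∧
    ∀ t p, Φ (τ t p) = φ t (Φ p)

/-- The immersion read in the preferred chart at `p`. -/
def localRep (Φ : N → V4) (p : N) : EuclideanSpace ℝ (Fin 2) → V4 :=
  fun u => Φ ((extChartAt (𝓡 2) p).symm u)

/-- The first partial derivatives of the immersion in the preferred chart at `p`. -/
def partialRep (Φ : N → V4) (p : N) (i : Fin 2) (u : EuclideanSpace ℝ (Fin 2)) : V4 :=
  fderiv ℝ (localRep Φ p) u (EuclideanSpace.single i 1)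

/-- `η` is a unit normal vector of the surface at `p`, tangent to the space form. -/
def IsUnitNormal (ρ : ℝ) (Φ : N → V4) (p : N) (η : V4) : Prop :=
  form ρ η η = 1 ∧ IsTangent ρ (Φ p) η ∧
    ∀ i, form ρ (partialRep Φ p i (extChartAt (𝓡 2) p p)) η = 0

/-- The matrix of the first fundamental form at `p`. -/
def firstForm (ρ : ℝ) (Φ : N → V4) (p : N) : Matrix (Fin 2) (Fin 2) ℝ :=
  Matrix.of fun i j => form ρ (partialRep Φ p i (extChartAt (𝓡 2) p p))
    (partialRep Φ p j (extChartAt (𝓡 2) p p))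

/-- The matrix of the second fundamental form at `p` in the direction of the unit normal `η`. As `η`
is tangent to the space form and normal to `N`, the Levi-Civita connection of the space form may be
replaced by the derivative of `ℝ⁴`. -/
def secondForm (ρ : ℝ) (Φ : N → V4) (p : N) (η : V4) : Matrix (Fin 2) (Fin 2) ℝ :=
  Matrix.of fun i j => form ρ
    (fderiv ℝ (partialRep Φ p j) (extChartAt (𝓡 2) p p) (EuclideanSpace.single i 1)) η

/-- The matrix of the shape operator `A_η` at `p`. -/
def shapeMatrix (ρ : ℝ) (Φ : N → V4) (p : N) (η : V4) : Matrix (Fin 2) (Fin 2) ℝ :=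
  (firstForm ρ Φ p)⁻¹ * secondForm ρ Φ p η

/-- The principal curvatures: the eigenvalues of the shape operator. -/
def principalCurvatures (ρ : ℝ) (Φ : N → V4) (p : N) (η : V4) : Set ℝ :=
  spectrum ℝ (shapeMatrix ρ Φ p η)

/-- The mean curvature. -/
def meanCurvature (ρ : ℝ) (Φ : N → V4) (p : N) (η : V4) : ℝ :=
  (shapeMatrix ρ Φ p η).trace / 2

/-- The Gaussian curvature. -/
def gaussCurvature (ρ : ℝ) (Φ : N → V4) (p : N) (η : V4) : ℝ :=
  (shapeMatrix ρ Φ p η).det + ρ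

/-- The skew curvature `2 √(H² - K + ρ) = |κ₁ - κ₂|`; it does not depend on the sign of `η`. -/
def skewCurvature (ρ : ℝ) (Φ : N → V4) (p : N) (η : V4) : ℝ :=
  2 * √(meanCurvature ρ Φ p η ^ 2 - gaussCurvature ρ Φ p η + ρ)

/-- The skew curvature is the constant `c`. -/
def HasConstantSkewCurvature (ρ : ℝ) (Φ : N → V4) (c : ℝ) : Prop :=
  ∀ p η, IsUnitNormal ρ Φ p η → skewCurvature ρ Φ p η = c

/-- The surface is isoparametric: its two principal curvatures are constant (up to the choice of the
unit normal, since `N` need not be orientable). -/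
def IsIsoparametric (ρ : ℝ) (Φ : N → V4) : Prop :=
  ∃ a b : ℝ, ∀ p, ∃ η, IsUnitNormal ρ Φ p η ∧ principalCurvatures ρ Φ p η = {a, b}

/-- `γ`, defined on the open interval `I`, is a profile curve of the surface, parametrized by
arc-length: it is orthogonal to the orbits of the group. -/
structure IsProfileCurve (ρ : ℝ) (Φ : N → V4) (φ : ℝ → V4 →ᵃ[ℝ] V4) (I : Set ℝ) (γ : ℝ → N) :
    Prop where
  isOpen : IsOpen I
  ordConnected : I.OrdConnected
  smooth : ContMDiffOn 𝓘(ℝ, ℝ) (𝓡 2) ∞ γ I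
  unit_speed : ∀ s ∈ I, form ρ (deriv (fun r => Φ (γ r)) s) (deriv (fun r => Φ (γ r)) s) = 1
  orthogonal : ∀ s ∈ I, form ρ (deriv (fun r => Φ (γ r)) s) (killing φ (Φ (γ s))) = 0

end Surfaces

/-- `ν` is a smooth unit normal field, along the unit speed curve `α : I → ℝ⁴` lying in the totally
geodesic surface with data `(n, d)`, which is tangent to this totally geodesic surface. Along `α`
there are exactly two such fields, `ν` and `-ν`, one for each orientation. -/
structure IsUnitNormalAlong (ρ : ℝ) (n : V4) (I : Set ℝ) (α ν : ℝ → V4) : Prop where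
  smooth : ContDiffOn ℝ ∞ ν I
  unit : ∀ s ∈ I, form ρ (ν s) (ν s) = 1
  tangent : ∀ s ∈ I, IsTangent ρ (α s) (ν s)
  tangent_surface : ∀ s ∈ I, form ρ n (ν s) = 0
  normal : ∀ s ∈ I, form ρ (deriv α s) (ν s) = 0

/-- The signed curvature `⟨∇_T T, ν⟩` of the unit speed curve `α` with respect to its unit normal
field `ν`. As `ν` is tangent to the space form, `∇_T T` may be replaced by the second derivative
in `ℝ⁴`. -/
def signedCurvature (ρ : ℝ) (α ν : ℝ → V4) (s : ℝ) : ℝ :=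
  form ρ (deriv (deriv α) s) (ν s)

/-- The Euler-Lagrange equation of the energy `∫ exp (μ κ) ds`, acting on curves of the 2-space form
of curvature `ρ`, for a curvature function `κ` of the arc-length parameter. -/
def SatisfiesEulerLagrange (ρ μ : ℝ) (I : Set ℝ) (κ : ℝ → ℝ) : Prop :=
  ContDiffOn ℝ 2 κ I ∧ ∀ s ∈ I,
    deriv (deriv fun r => Real.exp (μ * κ r)) s
      + (κ s ^ 2 - κ s / μ + ρ) * Real.exp (μ * κ s) = 0

end SkewRot

end

namespace SkewRot

/-! ### Linear algebra of the ambient bilinear form. -/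

section Form

variable (ρ : ℝ)

/-! Write the Killing field of the group as `X = B (x - o)`, with `B` skew for the ambient form.
Since `B` vanishes on a plane, the 2-form `ω(x, y) = ⟨B x, y⟩` is decomposable. This single fact
(the field `cyclic` of `IsGenerator`) replaces a case distinction between Euclidean, spherical,
hyperbolic and parabolic rotations: it gives that `B y` is parallel to `B x` whenever `y ⊥ B x` and
`B x` is not null (`map_eq_smul`).

The surface misses the zeros of `X`. At a zero `p` the group would fix `p` and rotate the tangent
plane, so the second fundamental form, being invariant, would be umbilic and the skew curvature
would be `0`, not `c > 0` (`killing_ne_zero_of_skewCurvature`).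

Along a profile curve `α` with tangent `T ⊥ X` one gets `X' = B T ∥ X`, so the unit direction `n` of
`X` is constant and `⟨n, α⟩` is constant: `α` lies in a totally geodesic surface
(`exists_killing_direction`). Let `ν` be the unit normal of `α` there and `G = ⟨X, n⟩ = |X|`. The
Weingarten equation along `α` and along the orbits gives, for the normal `-ν`, the principal
curvatures `κ₁ = -κ` and `κ₂ = ⟨B ν, n⟩ / G` (`curvatures_along_profile`). The continuous function
`κ₁ - κ₂` has absolute value `c`, hence constant sign, and the choice of `ν` makes it `c`.

Finally, differentiating `κ₂ G = ⟨B ν, n⟩` gives the Codazzi equation `κ' G = -c G'`, so `exp (-κ /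
c)` is a constant multiple of `G`; differentiating `G` twice gives the Gauss equation `G'' = -(κ² +
c κ + ρ) G`. With `μ = -1 / c` this is the Euler–Lagrange equation (`satisfiesEulerLagrange`). -/

theorem form_comm (x y : V4) : form ρ x y = form ρ y x := by
  simp only [form]; ring

theorem form_add_left (x y z : V4) : form ρ (x + y) z = form ρ x z + form ρ y z := by
  simp only [form, Pi.add_apply]; ring

theorem form_smul_left (a : ℝ) (x z : V4) : form ρ (a • x) z = a * form ρ x z := by
  simp only [form, Pi.smul_apply, smul_eq_mul]; ring

theorem form_add_right (x y z : V4) : form ρ x (y + z) = form ρ x y + form ρ x z := by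
  simp only [form, Pi.add_apply]; ring

theorem form_smul_right (a : ℝ) (x z : V4) : form ρ x (a • z) = a * form ρ x z := by
  simp only [form, Pi.smul_apply, smul_eq_mul]; ring

theorem form_neg_left (x z : V4) : form ρ (-x) z = -form ρ x z := by
  simp only [form, Pi.neg_apply]; ring

theorem form_neg_right (x z : V4) : form ρ x (-z) = -form ρ x z := by
  simp only [form, Pi.neg_apply]; ring

theorem form_sub_right (x y z : V4) : form ρ x (y - z) = form ρ x y - form ρ x z := by
  simp only [form, Pi.sub_apply]; ring

theorem form_zero_left (z : V4) : form ρ 0 z = 0 := by simp [form]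

theorem form_zero_right (z : V4) : form ρ z 0 = 0 := by simp [form]

/-- The ambient metric as a bilinear form. -/
noncomputable def formBilin : LinearMap.BilinForm ℝ V4 :=
  LinearMap.mk₂ ℝ (form ρ) (form_add_left ρ) (form_smul_left ρ) (form_add_right ρ)
    (form_smul_right ρ)

theorem formBilin_apply (x y : V4) : formBilin ρ x y = form ρ x y := rfl

theorem form_sum_left {ι : Type*} (s : Finset ι) (f : ι → V4) (z : V4) :
    form ρ (∑ i ∈ s, f i) z = ∑ i ∈ s, form ρ (f i) z := by
  simp only [← formBilin_apply, map_sum, LinearMap.sum_apply]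

variable {ρ}

theorem eq_zero_of_form_eq_zero {x : V4} (h : ∀ y, form ρ x y = 0) : x = 0 := by
  have hs : ∀ i, form ρ x (Pi.single i 1) = 0 := fun i => h _
  have h0 := hs 0
  have h1 := hs 1
  have h2 := hs 2
  have h3 := hs 3
  simp only [form] at h0 h1 h2 h3
  split_ifs at h0 h1 h2 h3 <;> simp at h0 h1 h2 h3 <;> ext i <;> fin_cases i <;> assumption

/-- A vector is determined by its products with an orthogonal frame. -/
theorem eq_sum_of_orthogonal_frame {f : Fin 4 → V4} (hne : ∀ i, form ρ (f i) (f i) ≠ 0)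
    (hf : ∀ i j, i ≠ j → form ρ (f i) (f j) = 0) (y : V4) :
    y = ∑ i, (form ρ y (f i) / form ρ (f i) (f i)) • f i := by
  have hli : LinearIndependent ℝ f := by
    refine LinearMap.BilinForm.linearIndependent_of_iIsOrtho (B := formBilin ρ) (v := f) ?_ ?_
    · intro i j hij
      exact hf i j hij
    · intro i hi
      exact hne i hi
  let b := basisOfLinearIndependentOfCardEqFinrank hli (by simp)
  have hb : ∀ i, b i = f i := fun i => by simp [b]
  have hy : y = ∑ i, b.repr y i • f i := by
    conv_lhs => rw [← b.sum_repr y]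
    simp only [hb]
  have hc : ∀ i, form ρ y (f i) = b.repr y i * form ρ (f i) (f i) := by
    intro i
    conv_lhs => rw [hy]
    rw [form_sum_left, Finset.sum_eq_single i]
    · rw [form_smul_left]
    · intro j _ hj
      rw [form_smul_left, hf j i hj, mul_zero]
    · simp
  conv_lhs => rw [hy]
  refine Finset.sum_congr rfl fun i _ => ?_
  rw [hc i, mul_div_cancel_right₀ _ (hne i)]

theorem eq_add_of_orthogonal_frame {a b c d : V4} (ha : form ρ a a ≠ 0) (hb : form ρ b b ≠ 0)
    (hc : form ρ c c ≠ 0) (hd : form ρ d d ≠ 0) (hab : form ρ a b = 0) (hac : form ρ a c = 0)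
    (had : form ρ a d = 0) (hbc : form ρ b c = 0) (hbd : form ρ b d = 0) (hcd : form ρ c d = 0)
    (y : V4) :
    y = (form ρ y a / form ρ a a) • a + (form ρ y b / form ρ b b) • b
      + (form ρ y c / form ρ c c) • c + (form ρ y d / form ρ d d) • d := by
  have h := eq_sum_of_orthogonal_frame (ρ := ρ) (f := ![a, b, c, d]) ?_ ?_ y
  · simpa [Fin.sum_univ_four] using h
  · intro i
    fin_cases i <;> assumption
  · intro i j hij
    fin_cases i <;> fin_cases j <;>
      first
      | exact absurd rfl hij
      | assumption
      | (rw [form_comm]; assumption)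

theorem hasDerivAt_form {f g : ℝ → V4} {f' g' : V4} {t : ℝ} (hf : HasDerivAt f f' t)
    (hg : HasDerivAt g g' t) :
    HasDerivAt (fun s => form ρ (f s) (g s)) (form ρ f' (g t) + form ρ (f t) g') t := by
  have hf' := hasDerivAt_pi.1 hf
  have hg' := hasDerivAt_pi.1 hg
  have h := ((((hf' 0).mul (hg' 0)).add ((hf' 1).mul (hg' 1))).add ((hf' 2).mul (hg' 2))).add
    (((hf' 3).mul (hg' 3)).const_mul (if ρ < 0 then (-1 : ℝ) else 1))
  refine h.congr_deriv ?_
  simp only [SkewRot.form]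
  ring

theorem contDiffOn_form {n : WithTop ℕ∞} {f g : ℝ → V4} {s : Set ℝ} (hf : ContDiffOn ℝ n f s)
    (hg : ContDiffOn ℝ n g s) : ContDiffOn ℝ n (fun t => form ρ (f t) (g t)) s := by
  have hf' := contDiffOn_pi.1 hf
  have hg' := contDiffOn_pi.1 hg
  exact ((((hf' 0).mul (hg' 0)).add ((hf' 1).mul (hg' 1))).add ((hf' 2).mul (hg' 2))).add
    (contDiffOn_const.mul ((hf' 3).mul (hg' 3)))

end Form

/-! ### The vector product of three vectors of `ℝ⁴`, used to build smooth unit normals. -/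

section Cross

/-- The determinant of the `3 × 3` matrix formed by the entries `i`, `j`, `k` of three vectors. -/
def minor (a b c : V4) (i j k : Fin 4) : ℝ :=
  a i * (b j * c k - b k * c j) - a j * (b i * c k - b k * c i) + a k * (b i * c j - b j * c i)

/-- The vector product of three vectors, orthogonal to each of them. -/
noncomputable def cross (ρ : ℝ) (a b c : V4) : V4 :=
  ![minor a b c 1 2 3, -minor a b c 0 2 3, minor a b c 0 1 3,
    -(if ρ < 0 then -1 else 1) * minor a b c 0 1 2]

variable {ρ : ℝ}

theorem form_cross_fst (a b c : V4) : form ρ (cross ρ a b c) a = 0 := by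
  simp only [form, cross, minor]
  split_ifs <;> simp <;> ring

theorem form_cross_snd (a b c : V4) : form ρ (cross ρ a b c) b = 0 := by
  simp only [form, cross, minor]
  split_ifs <;> simp <;> ring

theorem form_cross_trd (a b c : V4) : form ρ (cross ρ a b c) c = 0 := by
  simp only [form, cross, minor]
  split_ifs <;> simp <;> ring

theorem form_cross_self {a b c : V4} (hab : form ρ a b = 0) (hac : form ρ a c = 0)
    (hbc : form ρ b c = 0) :
    form ρ (cross ρ a b c) (cross ρ a b c) =
      (if ρ < 0 then -1 else 1) * (form ρ a a * form ρ b b * form ρ c c) := by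
  -- The right side is the Gram determinant of `a`, `b`, `c` times the determinant of the ambient
  -- form.
  have key : form ρ (cross ρ a b c) (cross ρ a b c) = (if ρ < 0 then -1 else 1) *
      (form ρ a a * form ρ b b * form ρ c c + 2 * form ρ a b * form ρ b c * form ρ a c
        - form ρ a a * form ρ b c ^ 2 - form ρ b b * form ρ a c ^ 2
        - form ρ c c * form ρ a b ^ 2) := by
    simp only [form, cross, minor]
    split_ifs <;> simp <;> ring
  rw [key, hab, hac, hbc]
  ring

theorem contDiffOn_cross {n : WithTop ℕ∞} {a b c : ℝ → V4} {s : Set ℝ}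
    (ha : ContDiffOn ℝ n a s) (hb : ContDiffOn ℝ n b s) (hc : ContDiffOn ℝ n c s) :
    ContDiffOn ℝ n (fun t => cross ρ (a t) (b t) (c t)) s := by
  have ha' := contDiffOn_pi.1 ha
  have hb' := contDiffOn_pi.1 hb
  have hc' := contDiffOn_pi.1 hc
  have hm : ∀ i j k, ContDiffOn ℝ n (fun t => minor (a t) (b t) (c t) i j k) s := fun i j k =>
    (((ha' i).mul (((hb' j).mul (hc' k)).sub ((hb' k).mul (hc' j)))).sub
      ((ha' j).mul (((hb' i).mul (hc' k)).sub ((hb' k).mul (hc' i))))).add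
      ((ha' k).mul (((hb' i).mul (hc' j)).sub ((hb' j).mul (hc' i))))
  refine contDiffOn_pi.2 fun i => ?_
  fin_cases i
  · exact hm 1 2 3
  · exact (hm 0 2 3).neg
  · exact hm 0 1 3
  · exact contDiffOn_const.mul (hm 0 1 2)

end Cross

/-! ### The space form as a hypersurface: its normal, and positivity of the induced metric. -/

section Model

/-- A normal vector of the space form in `ℝ⁴` at `x`. -/
noncomputable def modelNormal (ρ : ℝ) (x : V4) : V4 := if ρ = 0 then Pi.single 3 1 else x

variable {ρ : ℝ}

theorem isTangent_iff {x v : V4} : IsTangent ρ x v ↔ form ρ (modelNormal ρ x) v = 0 := by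
  by_cases h : ρ = 0
  · subst h; simp [IsTangent, modelNormal, form]
  · simp [IsTangent, modelNormal, h]

theorem form_modelNormal_self {x : V4} (hx : x ∈ spaceForm ρ) :
    form ρ (modelNormal ρ x) (modelNormal ρ x) = if ρ = 0 then 1 else 1 / ρ := by
  by_cases h : ρ = 0
  · subst h; simp [modelNormal, form]
  · simp [modelNormal, h, hx.2.1 h]

theorem form_modelNormal_self_ne {x : V4} (hx : x ∈ spaceForm ρ) :
    form ρ (modelNormal ρ x) (modelNormal ρ x) ≠ 0 := by
  rw [form_modelNormal_self hx]
  split_ifs with h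
  · exact one_ne_zero
  · exact one_div_ne_zero h

/-- The metric of the space form is positive definite. -/
theorem form_self_pos_of_isTangent {x v : V4} (hx : x ∈ spaceForm ρ) (hv : IsTangent ρ x v)
    (hne : v ≠ 0) : 0 < form ρ v v := by
  by_cases h : ρ < 0
  · have h1 := hx.2.1 h.ne
    have h2 := hx.2.2 h
    have h3 := hv.2 h.ne
    have h4 : 1 / ρ < 0 := one_div_neg.2 h
    simp only [form, if_pos h] at h1 h3 ⊢
    -- For `ρ < 0` the position vector is timelike (`e1`), and Cauchy–Schwarz on the spatial parts
    -- forces a nonzero vector orthogonal to it to be spacelike.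
    have e3 : x 0 * v 0 + x 1 * v 1 + x 2 * v 2 = x 3 * v 3 := by linarith
    have e1 : x 0 ^ 2 + x 1 ^ 2 + x 2 ^ 2 < x 3 ^ 2 := by nlinarith
    have cs : (x 3 * v 3) ^ 2 ≤ (x 0 ^ 2 + x 1 ^ 2 + x 2 ^ 2) * (v 0 ^ 2 + v 1 ^ 2 + v 2 ^ 2) := by
      rw [← e3]
      nlinarith [sq_nonneg (x 0 * v 1 - x 1 * v 0), sq_nonneg (x 0 * v 2 - x 2 * v 0),
        sq_nonneg (x 1 * v 2 - x 2 * v 1)]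
    by_cases hz : v 0 ^ 2 + v 1 ^ 2 + v 2 ^ 2 = 0
    · exfalso
      apply hne
      have z0 : v 0 = 0 := by nlinarith [sq_nonneg (v 0), sq_nonneg (v 1), sq_nonneg (v 2)]
      have z1 : v 1 = 0 := by nlinarith [sq_nonneg (v 0), sq_nonneg (v 1), sq_nonneg (v 2)]
      have z2 : v 2 = 0 := by nlinarith [sq_nonneg (v 0), sq_nonneg (v 1), sq_nonneg (v 2)]
      have z3 : v 3 = 0 := by
        rw [z0, z1, z2] at e3
        have : x 3 * v 3 = 0 := by linarith
        exact (mul_eq_zero.1 this).resolve_left h2.ne'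
      ext i
      fin_cases i <;> assumption
    · have hp : 0 < v 0 ^ 2 + v 1 ^ 2 + v 2 ^ 2 := lt_of_le_of_ne (by positivity) (Ne.symm hz)
      have : x 3 ^ 2 * v 3 ^ 2 < x 3 ^ 2 * (v 0 ^ 2 + v 1 ^ 2 + v 2 ^ 2) := by
        calc x 3 ^ 2 * v 3 ^ 2 = (x 3 * v 3) ^ 2 := by ring
          _ ≤ _ := cs
          _ < _ := mul_lt_mul_of_pos_right e1 hp
      have := lt_of_mul_lt_mul_left this (sq_nonneg _)
      linarith
  · simp only [form, if_neg h]
    have hi : ∃ i, v i ≠ 0 := Function.ne_iff.1 hne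
    obtain ⟨i, hi⟩ := hi
    have hp : 0 < v i * v i := mul_self_pos.2 hi
    fin_cases i <;> simp only [Fin.zero_eta, Fin.mk_one, Fin.reduceFinMk] at hp <;>
      nlinarith [mul_self_nonneg (v 0), mul_self_nonneg (v 1), mul_self_nonneg (v 2),
        mul_self_nonneg (v 3)]

/-- A scaling factor normalizing the vector product of a normal vector of the space form and two
orthonormal tangent vectors. -/
noncomputable def crossScale (ρ : ℝ) : ℝ := if ρ = 0 then 1 else √|ρ|

theorem form_crossScale_smul_cross {x a b : V4} (hx : x ∈ spaceForm ρ)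
    (ha : form ρ (modelNormal ρ x) a = 0) (hb : form ρ (modelNormal ρ x) b = 0)
    (hab : form ρ a b = 0) (haa : form ρ a a = 1) (hbb : form ρ b b = 1) :
    form ρ (crossScale ρ • cross ρ (modelNormal ρ x) a b)
      (crossScale ρ • cross ρ (modelNormal ρ x) a b) = 1 := by
  rw [form_smul_left, form_smul_right, form_cross_self ha hb hab, haa, hbb,
    form_modelNormal_self hx]
  -- For `ρ ≠ 0` the vector product has square `1 / |ρ|`: the sign of the ambient form cancels the
  -- sign of `⟨x, x⟩ = 1 / ρ`.
  rcases lt_trichotomy ρ 0 with h | h | h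
  · simp only [crossScale, if_neg h.ne, if_pos h]
    rw [← mul_assoc, Real.mul_self_sqrt (abs_nonneg _), abs_of_neg h]
    have := h.ne
    field_simp
  · simp [crossScale, h]
  · simp only [crossScale, if_neg h.ne', if_neg h.le.not_gt]
    rw [← mul_assoc, Real.mul_self_sqrt (abs_nonneg _), abs_of_pos h]
    have := h.ne'
    field_simp

end Model

/-! ### The infinitesimal generator of a rotation group. -/

section Rotation

variable {ρ : ℝ} {φ : ℝ → V4 →ᵃ[ℝ] V4}

/-- `B` is the linear part of the Killing field of the group `φ`, and `o` is a common fixed point of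
`φ`. -/
structure IsGenerator (ρ : ℝ) (φ : ℝ → V4 →ᵃ[ℝ] V4) (B : V4 →ₗ[ℝ] V4) (o : V4) : Prop where
  apply_eq : ∀ t x, φ t x = o + (φ t).linear (x - o)
  hasDerivAt_linear : ∀ v t, HasDerivAt (fun s => (φ s).linear v) ((φ t).linear (B v)) t
  skew : ∀ v w, form ρ (B v) w = -form ρ v (B w)
  ne_zero : B ≠ 0
  cyclic : ∀ x y z, form ρ (B x) y • B z + form ρ (B y) z • B x + form ρ (B z) x • B y = 0
  base_eq_zero : ρ ≠ 0 → o = 0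
  map_single : ρ = 0 → B (Pi.single 3 1) = 0

theorem linear_apply (f : V4 →ᵃ[ℝ] V4) (v : V4) : f.linear v = f v - f 0 := by
  have := f.linearMap_vsub v 0
  simpa using this

/-- With `ω(x, y) = ⟨B x, y⟩`, this says that `ω ∧ B = 0`, the algebraic form of `B` having rank at
most two. Three vectors are dependent modulo the plane `W`, so some nontrivial combination of `B x`,
`B y`, `B z` vanishes; pairing it with `x`, `y`, `z` identifies its coefficients, up to a factor,
with the values of `ω`. -/
theorem cyclic_of_finrank_eq_two {B : V4 →ₗ[ℝ] V4} {W : Submodule ℝ V4}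
    (hskew : ∀ v w, form ρ (B v) w = -form ρ v (B w)) (hW : Module.finrank ℝ W = 2)
    (hB : ∀ w ∈ W, B w = 0) (x y z : V4) :
    form ρ (B x) y • B z + form ρ (B y) z • B x + form ρ (B z) x • B y = 0 := by
  have hself : ∀ v, form ρ (B v) v = 0 := fun v => by
    have := hskew v v
    rw [form_comm ρ v] at this
    linarith
  have hanti : ∀ v w, form ρ (B v) w = -form ρ (B w) v := fun v w => by
    rw [hskew, form_comm]
  have hdep : ¬ LinearIndependent ℝ (fun i : Fin 3 => W.mkQ (![x, y, z] i)) := by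
    intro h
    have h1 := h.fintype_card_le_finrank
    have h2 := W.finrank_quotient_add_finrank
    rw [hW] at h2
    simp at h1 h2
    omega
  obtain ⟨g, hg, i, hi⟩ := Fintype.not_linearIndependent_iff.1 hdep
  have hmem : B (g 0 • x + g 1 • y + g 2 • z) = 0 := by
    apply hB
    rw [← Submodule.ker_mkQ W, LinearMap.mem_ker]
    simpa [Fin.sum_univ_three] using hg
  simp only [map_add, map_smul] at hmem
  have pair : ∀ v, g 0 * form ρ (B x) v + g 1 * form ρ (B y) v + g 2 * form ρ (B z) v = 0 := by
    intro v
    have := congrArg (fun w => form ρ w v) hmem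
    simpa [form_add_left, form_smul_left, form_zero_left] using this
  have px := pair x
  have py := pair y
  have pz := pair z
  rw [hself, hanti y x] at px
  rw [hself, hanti z y] at py
  rw [hself, hanti x z] at pz
  set a := form ρ (B x) y
  set b := form ρ (B y) z
  set c := form ρ (B z) x
  -- After multiplication by a nonzero coefficient `g i`, the sum is a combination of the relation
  -- `hmem` and two of its pairings.
  suffices hs : g i • (a • B z + b • B x + c • B y) = 0 from
    (smul_eq_zero.1 hs).resolve_left hi
  fin_cases i
  · calc g 0 • (a • B z + b • B x + c • B y)
        = b • (g 0 • B x + g 1 • B y + g 2 • B z) + (g 0 * 0 + g 1 * -a + g 2 * c) • (0 : V4)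
          + (g 0 * a + g 1 * 0 + g 2 * -b) • B z - (g 0 * -c + g 1 * b + g 2 * 0) • B y := by
          module
      _ = 0 := by
          rw [hmem, py, pz]; simp
  · calc g 1 • (a • B z + b • B x + c • B y)
        = c • (g 0 • B x + g 1 • B y + g 2 • B z)
          - (g 0 * 0 + g 1 * -a + g 2 * c) • B z + (g 0 * -c + g 1 * b + g 2 * 0) • B x := by
          module
      _ = 0 := by
          rw [hmem, px, pz]; simp
  · calc g 2 • (a • B z + b • B x + c • B y)
        = a • (g 0 • B x + g 1 • B y + g 2 • B z)
          - (g 0 * a + g 1 * 0 + g 2 * -b) • B x + (g 0 * 0 + g 1 * -a + g 2 * c) • B y := by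
          module
      _ = 0 := by
          rw [hmem, px, py]; simp

/-- `o` is a point of the fixed line if `ρ = 0` and the origin otherwise; `B` is the derivative at
`0` of the linear parts. Skewness is the derivative of the invariance of the form, and `B ≠ 0`
because the group is nontrivial. -/
theorem IsRotationGroup.exists_isGenerator (h : IsRotationGroup ρ φ) :
    ∃ B o, IsGenerator ρ φ B o := by
  obtain ⟨o, ho, ho0⟩ : ∃ o, (∀ t, φ t o = o) ∧ (ρ ≠ 0 → o = 0) := by
    by_cases hρ : ρ = 0
    · obtain ⟨p, v, -, -, -, hf⟩ := h.fixes_line hρ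
      exact ⟨p, fun t => by simpa using hf t 0, fun h => absurd hρ h⟩
    · exact ⟨0, h.linear_of_ne hρ, fun _ => rfl⟩
  have happ : ∀ t x, φ t x = o + (φ t).linear (x - o) := fun t x => by
    have := (φ t).linearMap_vsub x o
    simp only [vsub_eq_sub, ho] at this
    rw [this]; abel
  have hadd : ∀ s t v, (φ (s + t)).linear v = (φ s).linear ((φ t).linear v) := fun s t v => by
    have h1 := h.map_add s t (v + o)
    rw [happ, happ s, happ t] at h1
    simpa using h1
  have hzero : ∀ v, (φ 0).linear v = v := fun v => by
    have h1 := h.map_zero (v + o)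
    rw [happ] at h1
    simpa [add_comm] using h1
  have hdiff : ∀ v, DifferentiableAt ℝ (fun t => (φ t).linear v) 0 := fun v => by
    have h1 : (fun t => (φ t).linear v) = fun t => φ t (v + o) - o := by
      funext t
      rw [happ]; simp
    rw [h1]
    exact (((h.smooth (v + o)).differentiable (by simp)) 0).sub_const _
  let B : V4 →ₗ[ℝ] V4 :=
    { toFun := fun v => deriv (fun t => (φ t).linear v) 0
      map_add' := fun v w => by
        simp only [_root_.map_add]
        exact deriv_fun_add (hdiff v) (hdiff w)
      map_smul' := fun a v => by
        simp only [map_smul, RingHom.id_apply]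
        exact deriv_fun_const_smul a (hdiff v) }
  have hB : ∀ v, HasDerivAt (fun t => (φ t).linear v) (B v) 0 := fun v => (hdiff v).hasDerivAt
  have hBt : ∀ v t, HasDerivAt (fun s => (φ s).linear v) ((φ t).linear (B v)) t := fun v t => by
    have h1 : (fun s => (φ s).linear v) =
        fun s => LinearMap.toContinuousLinearMap (φ t).linear ((φ (s - t)).linear v) := by
      funext s
      have := hadd t (s - t) v
      rw [add_sub_cancel] at this
      exact this
    rw [h1]
    have h2 : HasDerivAt (fun s => (φ (s - t)).linear v) (B v) t := by
      have h3 : HasDerivAt (fun u => (φ u).linear v) (B v) (t - t) := by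
        rw [sub_self]; exact hB v
      simpa using h3.comp_sub_const t t
    exact (LinearMap.toContinuousLinearMap (φ t).linear).hasFDerivAt.comp_hasDerivAt t h2
  have hskew : ∀ v w, form ρ (B v) w = -form ρ v (B w) := fun v w => by
    have h1 := hasDerivAt_form (ρ := ρ) (hB v) (hB w)
    simp only [h.preserves_form, hzero] at h1
    have := h1.unique (hasDerivAt_const _ _)
    linarith
  have hfix : ∀ w, (∀ t, φ t (w + o) = w + o) → B w = 0 := fun w hw => by
    have h1 : (fun t => (φ t).linear w) = fun _ => w := by
      funext t
      have := hw t
      rw [happ] at this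
      simpa [add_comm] using this
    have h2 := hB w
    rw [h1] at h2
    exact h2.unique (hasDerivAt_const _ _)
  -- In the flat case `B` preserves the hyperplane `x₃ = 0`, so by skewness `B e₃` is orthogonal to
  -- it; it is orthogonal to `e₃` as well.
  have hsingle : ρ = 0 → B (Pi.single 3 1) = 0 := fun hρ => by
    have hmodel : ∀ x : V4, x ∈ spaceForm ρ ↔ x 3 = 0 := fun x => by
      simp [spaceForm, hρ]
    have h3 : ∀ v : V4, v 3 = 0 → (B v) 3 = 0 := fun v hv => by
      have h1 : ∀ t, ((φ t).linear v) 3 = 0 := fun t => by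
        rw [linear_apply, Pi.sub_apply, (hmodel _).1 (h.preserves_model t v ((hmodel v).2 hv)),
          (hmodel _).1 (h.preserves_model t 0 ((hmodel 0).2 rfl)), sub_zero]
      have h2 := hasDerivAt_pi.1 (hB v) 3
      simp only [h1] at h2
      exact h2.unique (hasDerivAt_const _ _)
    have he : ∀ x : V4, form ρ (Pi.single 3 1) x = x 3 := fun x => by
      simp [form, hρ]
    have hself : form ρ (B (Pi.single 3 1)) (Pi.single 3 1) = 0 := by
      have := hskew (Pi.single 3 1) (Pi.single 3 1)
      rw [form_comm ρ (Pi.single 3 1)] at this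
      linarith
    refine eq_zero_of_form_eq_zero (ρ := ρ) fun y => ?_
    have hy : y = (y - y 3 • Pi.single 3 1) + y 3 • Pi.single 3 1 := by simp
    rw [hy, form_add_right, form_smul_right, hself, hskew, he, h3 _ (by simp)]
    simp
  -- In the flat case the kernel plane is spanned by the direction of the axis and the auxiliary
  -- vector `e₃`.
  obtain ⟨W, hW, hBW⟩ : ∃ W : Submodule ℝ V4, Module.finrank ℝ W = 2 ∧ ∀ w ∈ W, B w = 0 := by
    by_cases hρ : ρ = 0
    · obtain ⟨p, v, hp, hv3, hv, hf⟩ := h.fixes_line hρ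
      have hBv : B v = 0 := by
        have h1 : ∀ t, (φ t).linear v = v := fun t => by
          have h2 := (φ t).linearMap_vsub (p + (1 : ℝ) • v) (p + (0 : ℝ) • v)
          rw [hf, hf] at h2
          simpa using h2
        have h2 := hB v
        simp only [h1] at h2
        exact h2.unique (hasDerivAt_const _ _)
      have hli : LinearIndependent ℝ ![v, Pi.single 3 1] := by
        rw [LinearIndependent.pair_iff]
        intro s t hst
        have h3 := congrFun hst 3
        simp [hv3] at h3
        rw [h3] at hst
        simp only [zero_smul, add_zero, smul_eq_zero] at hst
        exact ⟨hst.resolve_right hv, h3⟩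
      refine ⟨Submodule.span ℝ (Set.range ![v, Pi.single 3 1]), ?_, ?_⟩
      · rw [finrank_span_eq_card hli]; simp
      · intro w hw
        have : Submodule.span ℝ (Set.range ![v, Pi.single 3 1]) ≤ LinearMap.ker B := by
          rw [Submodule.span_le]
          rintro _ ⟨i, rfl⟩
          fin_cases i
          · exact hBv
          · exact hsingle hρ
        exact this hw
    · obtain ⟨W, hW, hf⟩ := h.fixes_plane hρ
      refine ⟨W, hW, fun w hw => hfix w fun t => ?_⟩
      rw [ho0 hρ, add_zero, hf t w hw]
  refine ⟨B, o, happ, hBt, hskew, ?_, cyclic_of_finrank_eq_two hskew hW hBW, ho0, hsingle⟩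
  intro hB0
  obtain ⟨t, x, -, hx⟩ := h.nontrivial
  apply hx
  have h1 : ∀ s, HasDerivAt (fun s => (φ s).linear (x - o)) 0 s := fun s => by
    simpa [hB0] using hBt (x - o) s
  have h2 := is_const_of_deriv_eq_zero (fun s => (h1 s).differentiableAt)
    (fun s => (h1 s).deriv) t 0
  simp only [hzero] at h2
  rw [happ, h2]
  simp

namespace IsGenerator

variable {B : V4 →ₗ[ℝ] V4} {o : V4}

theorem hasDerivAt_orbit (h : IsGenerator ρ φ B o) (x : V4) (t : ℝ) :
    HasDerivAt (fun s => φ s x) ((φ t).linear (B (x - o))) t := by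
  have h1 : (fun s => φ s x) = fun s => o + (φ s).linear (x - o) := funext fun s => h.apply_eq s x
  rw [h1]
  exact (h.hasDerivAt_linear _ _).const_add _

theorem linear_zero (hφ : IsRotationGroup ρ φ) (v : V4) :
    (φ 0).linear v = v := by
  rw [linear_apply, hφ.map_zero, hφ.map_zero, sub_zero]

theorem killing_eq (h : IsGenerator ρ φ B o) (hφ : IsRotationGroup ρ φ) (x : V4) :
    killing φ x = B (x - o) := by
  rw [killing, (h.hasDerivAt_orbit x 0).deriv, linear_zero hφ]

theorem form_map_self (h : IsGenerator ρ φ B o) (v : V4) : form ρ (B v) v = 0 := by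
  have := h.skew v v
  rw [form_comm ρ v] at this
  linarith

/-- A vector orthogonal to the spacelike vector `B x` is mapped to a multiple of `B x`. -/
theorem map_eq_smul (h : IsGenerator ρ φ B o) {x y : V4} (hx : form ρ (B x) (B x) ≠ 0)
    (hxy : form ρ (B x) y = 0) :
    B y = (form ρ (B y) (B x) / form ρ (B x) (B x)) • B x := by
  -- With third vector `B x`, the term containing `⟨B x, y⟩` drops out and only multiples of `B x`
  -- and `B y` remain.
  have h1 := h.cyclic x y (B x)
  have h2 : form ρ (B (B x)) x = -form ρ (B x) (B x) := h.skew _ _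
  rw [hxy, h2, zero_smul, zero_add, neg_smul, add_neg_eq_zero] at h1
  rw [div_eq_inv_mul, mul_smul, h1, smul_smul, inv_mul_cancel₀ hx, one_smul]

end IsGenerator

end Rotation

/-! ### Tangent planes and the second fundamental form of the immersion in charts. -/

section Surface

open Filter Topology

variable {N : Type*} [TopologicalSpace N] [ChartedSpace (EuclideanSpace ℝ (Fin 2)) N]
  {ρ : ℝ} {Φ : N → V4}

/-- The image of the tangent plane at `q` under the differential of `Φ`. -/
noncomputable def tangentRange (Φ : N → V4) (q : N) : Submodule ℝ V4 :=
  LinearMap.range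
    (mfderiv (𝓡 2) 𝓘(ℝ, V4) Φ q : EuclideanSpace ℝ (Fin 2) →L[ℝ] V4).toLinearMap

theorem finrank_tangentRange_le (Φ : N → V4) (q : N) :
    Module.finrank ℝ (tangentRange Φ q) ≤ 2 := by
  have h : ∀ L : EuclideanSpace ℝ (Fin 2) →L[ℝ] V4,
      Module.finrank ℝ (LinearMap.range L.toLinearMap) ≤ 2 := fun L => by
    simpa using LinearMap.finrank_range_le L.toLinearMap
  exact h _

theorem hasDerivAt_comp_curve {q : N} {c : ℝ → N} {t : ℝ}
    (hΦ : MDifferentiableAt (𝓡 2) 𝓘(ℝ, V4) Φ q)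
    (hc : MDifferentiableAt 𝓘(ℝ, ℝ) (𝓡 2) c t) (hq : c t = q) :
    ∃ v ∈ tangentRange Φ q, HasDerivAt (fun s => Φ (c s)) v t := by
  subst hq
  have h := (hΦ.hasMFDerivAt.comp t hc.hasMFDerivAt)
  have key : ∀ (L : EuclideanSpace ℝ (Fin 2) →L[ℝ] V4) (M : ℝ →L[ℝ] EuclideanSpace ℝ (Fin 2)),
      HasFDerivAt (fun s => Φ (c s)) (L.comp M) t →
        HasDerivAt (fun s => Φ (c s)) (L (M 1)) t := fun L M h => h.hasDerivAt
  exact ⟨_, ⟨_, rfl⟩, key _ _ (hasMFDerivAt_iff_hasFDerivAt.1 h)⟩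

theorem mfderiv_eq_fderiv_localRep {p : N} (hΦ : MDifferentiableAt (𝓡 2) 𝓘(ℝ, V4) Φ p) :
    (mfderiv (𝓡 2) 𝓘(ℝ, V4) Φ p : EuclideanSpace ℝ (Fin 2) →L[ℝ] V4) =
      fderiv ℝ (localRep Φ p) (extChartAt (𝓡 2) p p) := by
  rw [hΦ.mfderiv]
  simp only [ModelWithCorners.range_eq_univ, fderivWithin_univ]
  rfl

theorem partialRep_mem_tangentRange {p : N} (hΦ : MDifferentiableAt (𝓡 2) 𝓘(ℝ, V4) Φ p)
    (i : Fin 2) : partialRep Φ p i (extChartAt (𝓡 2) p p) ∈ tangentRange Φ p := by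
  refine ⟨EuclideanSpace.single i 1, ?_⟩
  rw [mfderiv_eq_fderiv_localRep hΦ]
  rfl

theorem fderiv_localRep_apply (Φ : N → V4) (p : N) (u a : EuclideanSpace ℝ (Fin 2)) :
    fderiv ℝ (localRep Φ p) u a = ∑ i, a i • partialRep Φ p i u := by
  conv_lhs => rw [← (EuclideanSpace.basisFun (Fin 2) ℝ).sum_repr a]
  simp [partialRep]

theorem mem_tangentRange_iff {p : N} (hΦ : MDifferentiableAt (𝓡 2) 𝓘(ℝ, V4) Φ p) {v : V4} :
    v ∈ tangentRange Φ p ↔ ∃ a : EuclideanSpace ℝ (Fin 2),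
      ∑ i, a i • partialRep Φ p i (extChartAt (𝓡 2) p p) = v := by
  simp only [← fderiv_localRep_apply, ← mfderiv_eq_fderiv_localRep hΦ]
  rfl

theorem isUnitNormal_iff (hΦ : ContMDiff (𝓡 2) 𝓘(ℝ, V4) ∞ Φ) {p : N} {η : V4} :
    IsUnitNormal ρ Φ p η ↔ form ρ η η = 1 ∧ IsTangent ρ (Φ p) η ∧
      ∀ w ∈ tangentRange Φ p, form ρ w η = 0 := by
  have hd := hΦ.mdifferentiableAt (x := p) (by simp)
  refine and_congr_right fun _ => and_congr_right fun _ => ⟨fun h w hw => ?_, fun h i => ?_⟩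
  · obtain ⟨a, rfl⟩ := (mem_tangentRange_iff hd).1 hw
    rw [form_sum_left]
    exact Finset.sum_eq_zero fun i _ => by rw [form_smul_left, h i, mul_zero]
  · exact h _ (partialRep_mem_tangentRange hd i)

variable [IsManifold (𝓡 2) ∞ N]

theorem contDiffOn_localRep (hΦ : ContMDiff (𝓡 2) 𝓘(ℝ, V4) ∞ Φ) (p : N) :
    ContDiffOn ℝ ∞ (localRep Φ p) (extChartAt (𝓡 2) p).target := by
  rw [← contMDiffOn_iff_contDiffOn]
  exact hΦ.comp_contMDiffOn (contMDiffOn_extChartAt_symm p)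

theorem contDiffAt_localRep (hΦ : ContMDiff (𝓡 2) 𝓘(ℝ, V4) ∞ Φ) (p : N) :
    ContDiffAt ℝ ∞ (localRep Φ p) (extChartAt (𝓡 2) p p) :=
  (contDiffOn_localRep hΦ p).contDiffAt
    ((isOpen_extChartAt_target p).mem_nhds (mem_extChartAt_target p))

theorem contDiffAt_fderiv_localRep (hΦ : ContMDiff (𝓡 2) 𝓘(ℝ, V4) ∞ Φ) (p : N) :
    ContDiffAt ℝ ∞ (fderiv ℝ (localRep Φ p)) (extChartAt (𝓡 2) p p) :=
  (contDiffAt_localRep hΦ p).fderiv_right (m := ∞) (by simp)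

theorem fderiv_partialRep_apply (hΦ : ContMDiff (𝓡 2) 𝓘(ℝ, V4) ∞ Φ) (p : N) (j : Fin 2)
    (a : EuclideanSpace ℝ (Fin 2)) :
    fderiv ℝ (partialRep Φ p j) (extChartAt (𝓡 2) p p) a =
      fderiv ℝ (fderiv ℝ (localRep Φ p)) (extChartAt (𝓡 2) p p) a (EuclideanSpace.single j 1) := by
  have h := ((contDiffAt_fderiv_localRep hΦ p).differentiableAt (by simp)).hasFDerivAt
  have h2 := (h.clm_apply (hasFDerivAt_const (EuclideanSpace.single j (1 : ℝ)) _)).fderiv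
  change fderiv ℝ (fun u => fderiv ℝ (localRep Φ p) u (EuclideanSpace.single j 1)) _ a = _
  rw [h2]
  simp

theorem differentiableAt_partialRep (hΦ : ContMDiff (𝓡 2) 𝓘(ℝ, V4) ∞ Φ) (p : N) (j : Fin 2) :
    DifferentiableAt ℝ (partialRep Φ p j) (extChartAt (𝓡 2) p p) :=
  ((contDiffAt_fderiv_localRep hΦ p).differentiableAt (by simp)).clm_apply
    (differentiableAt_const _)

theorem fderiv_localRep_mem (hΦ : ContMDiff (𝓡 2) 𝓘(ℝ, V4) ∞ Φ) (p : N)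
    {u : EuclideanSpace ℝ (Fin 2)} (hu : u ∈ (extChartAt (𝓡 2) p).target)
    (a : EuclideanSpace ℝ (Fin 2)) :
    fderiv ℝ (localRep Φ p) u a ∈ tangentRange Φ ((extChartAt (𝓡 2) p).symm u) := by
  have h1 : MDifferentiableAt 𝓘(ℝ, EuclideanSpace ℝ (Fin 2)) (𝓡 2) (extChartAt (𝓡 2) p).symm u :=
    ((contMDiffOn_extChartAt_symm (n := ∞) p).contMDiffAt
      ((isOpen_extChartAt_target p).mem_nhds hu)).mdifferentiableAt (by simp)
  have h2 := (hΦ.mdifferentiableAt (x := (extChartAt (𝓡 2) p).symm u) (by simp)).hasMFDerivAt.comp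
    u h1.hasMFDerivAt
  have key : ∀ (L : EuclideanSpace ℝ (Fin 2) →L[ℝ] V4)
      (M : EuclideanSpace ℝ (Fin 2) →L[ℝ] EuclideanSpace ℝ (Fin 2)),
      HasFDerivAt (localRep Φ p) (L.comp M) u →
        fderiv ℝ (localRep Φ p) u a = L (M a) := fun L M h => by rw [h.fderiv]; rfl
  exact ⟨_, (key _ _ (hasMFDerivAt_iff_hasFDerivAt.1 h2)).symm⟩

/-- A curve through `p` read in the preferred chart at `p`. -/
theorem curve_in_chart {p : N} {c : ℝ → N} {t : ℝ}
    (hc : MDifferentiableAt 𝓘(ℝ, ℝ) (𝓡 2) c t) (hp : c t = p) :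
    DifferentiableAt ℝ (fun s => extChartAt (𝓡 2) p (c s)) t ∧
      ∀ᶠ s in 𝓝 t, extChartAt (𝓡 2) p (c s) ∈ (extChartAt (𝓡 2) p).target ∧
        (extChartAt (𝓡 2) p).symm (extChartAt (𝓡 2) p (c s)) = c s := by
  subst hp
  constructor
  · rw [← mdifferentiableAt_iff_differentiableAt]
    exact (mdifferentiableAt_extChartAt (mem_chart_source _ _)).comp t hc
  · filter_upwards [hc.continuousAt.preimage_mem_nhds
      (extChartAt_source_mem_nhds (I := 𝓡 2) (c t))] with s hs
    exact ⟨(extChartAt (𝓡 2) (c t)).map_source hs, (extChartAt (𝓡 2) (c t)).left_inv hs⟩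

/-- The Weingarten equation for a normal field `η` along a curve `c` of the surface. -/
theorem secondForm_along_curve (hΦ : ContMDiff (𝓡 2) 𝓘(ℝ, V4) ∞ Φ) {p : N} {c : ℝ → N} {t : ℝ}
    (hc : MDifferentiableAt 𝓘(ℝ, ℝ) (𝓡 2) c t) (hp : c t = p) {v : V4}
    (hv : HasDerivAt (fun s => Φ (c s)) v t) {η : ℝ → V4} {η' : V4} (hη : HasDerivAt η η' t)
    (hn : ∀ᶠ s in 𝓝 t, ∀ w ∈ tangentRange Φ (c s), form ρ w (η s) = 0) :
    ∃ a : EuclideanSpace ℝ (Fin 2),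
      ∑ i, a i • partialRep Φ p i (extChartAt (𝓡 2) p p) = v ∧
      ∀ j, ∑ i, a i * secondForm ρ Φ p (η t) i j =
        -form ρ (partialRep Φ p j (extChartAt (𝓡 2) p p)) η' := by
  obtain ⟨hu, hev⟩ := curve_in_chart hc hp
  set u := fun s => extChartAt (𝓡 2) p (c s) with hudef
  have hut : u t = extChartAt (𝓡 2) p p := by rw [hudef, ← hp]
  refine ⟨deriv u t, ?_, fun j => ?_⟩
  · have h1 : HasFDerivAt (localRep Φ p) (fderiv ℝ (localRep Φ p) (u t)) (u t) := by
      rw [hut]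
      exact ((contDiffAt_localRep hΦ p).differentiableAt (by simp)).hasFDerivAt
    have h2 := h1.comp_hasDerivAt t hu.hasDerivAt
    have h3 : HasDerivAt (fun s => Φ (c s)) (fderiv ℝ (localRep Φ p) (u t) (deriv u t)) t := by
      refine h2.congr_of_eventuallyEq ?_
      filter_upwards [hev] with s hs
      exact congrArg Φ hs.2.symm
    rw [← fderiv_localRep_apply, ← hut]
    exact h3.unique hv
  · have h1 : HasFDerivAt (partialRep Φ p j) (fderiv ℝ (partialRep Φ p j) (u t)) (u t) := by
      rw [hut]
      exact (differentiableAt_partialRep hΦ p j).hasFDerivAt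
    have h2 := hasDerivAt_form (ρ := ρ) (h1.comp_hasDerivAt t hu.hasDerivAt) hη
    -- The Weingarten equation is the derivative of `⟨∂ⱼΦ, η⟩ = 0` along the curve.
    have h3 : (fun s => form ρ ((partialRep Φ p j ∘ u) s) (η s)) =ᶠ[𝓝 t] fun _ => 0 := by
      filter_upwards [hev, hn] with s hs hns
      apply hns
      have := fderiv_localRep_mem hΦ p hs.1 (EuclideanSpace.single j 1)
      rwa [hs.2] at this
    have h4 := (h2.congr_of_eventuallyEq h3.symm).unique (hasDerivAt_const t (0 : ℝ))
    rw [Function.comp_apply, hut] at h4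
    have h5 : fderiv ℝ (partialRep Φ p j) (extChartAt (𝓡 2) p p) (deriv u t) =
        ∑ i, (deriv u t) i • fderiv ℝ (partialRep Φ p j) (extChartAt (𝓡 2) p p)
          (EuclideanSpace.single i 1) := by
      conv_lhs => rw [← (EuclideanSpace.basisFun (Fin 2) ℝ).sum_repr (deriv u t)]
      simp
    rw [h5, form_sum_left] at h4
    simp only [form_smul_left] at h4
    simp only [secondForm, Matrix.of_apply]
    linarith

theorem modelNormal_orthogonal_tangentRange (hΦ : IsImmersedSurface ρ Φ) {p : N} {w : V4}
    (hw : w ∈ tangentRange Φ p) : form ρ (modelNormal ρ (Φ p)) w = 0 := by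
  have hd := hΦ.smooth.mdifferentiableAt (x := p) (by simp)
  obtain ⟨a, rfl⟩ := (mem_tangentRange_iff hd).1 hw
  rw [← fderiv_localRep_apply]
  set u := fun t : ℝ => extChartAt (𝓡 2) p p + t • a
  have hu : HasDerivAt u a 0 := by
    have := ((hasDerivAt_id (0 : ℝ)).smul_const a).const_add (extChartAt (𝓡 2) p p)
    rwa [one_smul] at this
  have hu0 : u 0 = extChartAt (𝓡 2) p p := by simp [u]
  have h1 : HasFDerivAt (localRep Φ p) (fderiv ℝ (localRep Φ p) (u 0)) (u 0) := by
    rw [hu0]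
    exact ((contDiffAt_localRep hΦ.smooth p).differentiableAt (by simp)).hasFDerivAt
  have h2 := h1.comp_hasDerivAt 0 hu
  -- This holds even when `u t` leaves the chart target, since the inverse chart still takes some
  -- value in `N`.
  have h3 : ∀ t, localRep Φ p (u t) ∈ spaceForm ρ := fun t => hΦ.mem _
  have h4 : localRep Φ p (u 0) = Φ p := by
    rw [hu0]; exact congrArg Φ (extChartAt_to_inv p)
  by_cases hρ : ρ = 0
  · have h5 := hasDerivAt_pi.1 h2 3
    have h6 : (fun t => (localRep Φ p ∘ u) t 3) = fun _ => 0 := funext fun t => (h3 t).1 hρ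
    rw [h6] at h5
    have h7 := h5.unique (hasDerivAt_const _ _)
    rw [← isTangent_iff]
    refine ⟨fun _ => ?_, fun h => absurd hρ h⟩
    rw [← hu0]; exact h7
  · have h5 := hasDerivAt_form (ρ := ρ) h2 h2
    have h6 : (fun t => form ρ ((localRep Φ p ∘ u) t) ((localRep Φ p ∘ u) t)) = fun _ => 1 / ρ :=
      funext fun t => (h3 t).2.1 hρ
    rw [h6] at h5
    have h7 := h5.unique (hasDerivAt_const _ _)
    rw [form_comm, Function.comp_apply, h4, hu0] at h7
    rw [modelNormal, if_neg hρ]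
    linarith

end Surface

/-! ### Simultaneous diagonalization of the two fundamental forms. -/

section Matrix2

open Matrix

/-- If two vectors orthogonal for `g` are eigenvectors of `h` with respect to `g`, the invariants of
`g⁻¹ h` are those of the diagonal matrix of the eigenvalues. -/
theorem similar_diagonal_of_orthogonal_eigenvectors {g h : Matrix (Fin 2) (Fin 2) ℝ}
    {a b : Fin 2 → ℝ} {k l : ℝ} (haa : a ⬝ᵥ g *ᵥ a ≠ 0) (hbb : b ⬝ᵥ g *ᵥ b ≠ 0)
    (hab : a ⬝ᵥ g *ᵥ b = 0) (hba : b ⬝ᵥ g *ᵥ a = 0)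
    (ha : a ᵥ* h = k • a ᵥ* g) (hb : b ᵥ* h = l • b ᵥ* g) :
    ∃ R : (Matrix (Fin 2) (Fin 2) ℝ)ˣ,
      g⁻¹ * h = (↑R⁻¹ : Matrix _ _ ℝ) * diagonal (![k, l] : Fin 2 → ℝ) * (R : Matrix _ _ ℝ) := by
  let Q : Matrix (Fin 2) (Fin 2) ℝ := Matrix.of ![a, b]
  have hQg : Q * g * Qᵀ = diagonal (![a ⬝ᵥ g *ᵥ a, b ⬝ᵥ g *ᵥ b] : Fin 2 → ℝ) := by
    ext i j
    rw [Matrix.mul_assoc]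
    have hij : (Q * (g * Qᵀ)) i j = Q i ⬝ᵥ g *ᵥ (Q j) := by
      simp [Matrix.mul_apply, dotProduct, mulVec]
    rw [hij]
    fin_cases i <;> fin_cases j
    · rfl
    · exact hab
    · exact hba
    · rfl
  have hQh : Q * h = diagonal (![k, l] : Fin 2 → ℝ) * (Q * g) := by
    ext i j
    rw [diagonal_mul]
    fin_cases i
    · simpa [vecMul, dotProduct, Matrix.mul_apply, Q] using congrFun ha j
    · simpa [vecMul, dotProduct, Matrix.mul_apply, Q] using congrFun hb j
  -- The conjugating matrix is `Q g`, where the rows of `Q` are the eigenvectors: `Q g Qᵀ` is an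
  -- invertible diagonal matrix, so `Q g` and `Q` are invertible.
  have hdet : IsUnit (Q * g).det := by
    have h1 : IsUnit (Q * g * Qᵀ).det := by
      rw [hQg, det_diagonal, isUnit_iff_ne_zero, Fin.prod_univ_two]
      exact mul_ne_zero haa hbb
    rw [det_mul] at h1
    exact isUnit_of_mul_isUnit_left h1
  have hQ : IsUnit Q.det := by
    rw [det_mul] at hdet; exact isUnit_of_mul_isUnit_left hdet
  refine ⟨⟨Q * g, (Q * g)⁻¹, Matrix.mul_nonsing_inv _ hdet, Matrix.nonsing_inv_mul _ hdet⟩, ?_⟩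
  change g⁻¹ * h = (Q * g)⁻¹ * diagonal (![k, l] : Fin 2 → ℝ) * (Q * g)
  rw [Matrix.mul_assoc, ← hQh, Matrix.mul_inv_rev, Matrix.mul_assoc, ← Matrix.mul_assoc Q⁻¹,
    Matrix.nonsing_inv_mul Q hQ, Matrix.one_mul]

theorem invariants_of_similar_diagonal {S : Matrix (Fin 2) (Fin 2) ℝ} {k l : ℝ}
    {R : (Matrix (Fin 2) (Fin 2) ℝ)ˣ}
    (hS : S = (↑R⁻¹ : Matrix _ _ ℝ) * diagonal (![k, l] : Fin 2 → ℝ) * (R : Matrix _ _ ℝ)) :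
    S.trace = k + l ∧ S.det = k * l ∧ spectrum ℝ S = {k, l} := by
  refine ⟨?_, ?_, ?_⟩
  · rw [hS, Matrix.trace_mul_comm, ← Matrix.mul_assoc, Units.mul_inv, Matrix.one_mul]
    simp [Matrix.trace, Fin.sum_univ_two]
  · rw [hS, Matrix.det_units_conj']
    simp
  · rw [hS, spectrum.units_conjugate', spectrum_diagonal]
    simp [Set.pair_comm]

end Matrix2

/-! ### Principal curvatures from principal directions, and normal curvature of curves. -/

section Surface

open Filter Topology

variable {N : Type*} [TopologicalSpace N] [ChartedSpace (EuclideanSpace ℝ (Fin 2)) N]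
  {ρ : ℝ} {Φ : N → V4}

/-- The principal curvatures and the skew curvature from two orthogonal principal directions. -/
theorem curvatures_of_principal_directions {p : N} {η v w : V4} {a b : EuclideanSpace ℝ (Fin 2)}
    {k l : ℝ} (ha : ∑ i, a i • partialRep Φ p i (extChartAt (𝓡 2) p p) = v)
    (hb : ∑ i, b i • partialRep Φ p i (extChartAt (𝓡 2) p p) = w)
    (hvv : form ρ v v ≠ 0) (hww : form ρ w w ≠ 0) (hvw : form ρ v w = 0)
    (hak : ∀ j, ∑ i, a i * secondForm ρ Φ p η i j =
      k * form ρ v (partialRep Φ p j (extChartAt (𝓡 2) p p)))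
    (hbl : ∀ j, ∑ i, b i * secondForm ρ Φ p η i j =
      l * form ρ w (partialRep Φ p j (extChartAt (𝓡 2) p p))) :
    principalCurvatures ρ Φ p η = {k, l} ∧ skewCurvature ρ Φ p η = |k - l| := by
  set g := firstForm ρ Φ p
  set h := secondForm ρ Φ p η
  have hg : ∀ x y : EuclideanSpace ℝ (Fin 2), (fun i => x i) ⬝ᵥ g.mulVec (fun i => y i) =
      form ρ (∑ i, x i • partialRep Φ p i (extChartAt (𝓡 2) p p))
        (∑ i, y i • partialRep Φ p i (extChartAt (𝓡 2) p p)) := fun x y => by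
    simp only [Fin.sum_univ_two, form_add_left, form_add_right, form_smul_left, form_smul_right,
      dotProduct, Matrix.mulVec, g, firstForm, Matrix.of_apply]
    ring
  have hg' : ∀ (x : EuclideanSpace ℝ (Fin 2)) (j : Fin 2), Matrix.vecMul (fun i => x i) g j =
      form ρ (∑ i, x i • partialRep Φ p i (extChartAt (𝓡 2) p p))
        (partialRep Φ p j (extChartAt (𝓡 2) p p)) := fun x j => by
    simp only [Fin.sum_univ_two, form_add_left, form_smul_left,
      dotProduct, Matrix.vecMul, g, firstForm, Matrix.of_apply]
  obtain ⟨R, hR⟩ := similar_diagonal_of_orthogonal_eigenvectors (g := g) (h := h)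
    (a := fun i => a i) (b := fun i => b i) (k := k) (l := l)
    (by rw [hg, ha]; exact hvv) (by rw [hg, hb]; exact hww) (by rw [hg, ha, hb]; exact hvw)
    (by rw [hg, ha, hb, form_comm]; exact hvw)
    (by
      ext j
      rw [Pi.smul_apply, hg', ha, smul_eq_mul, ← hak j]
      rfl)
    (by
      ext j
      rw [Pi.smul_apply, hg', hb, smul_eq_mul, ← hbl j]
      rfl)
  obtain ⟨htr, hdet, hspec⟩ := invariants_of_similar_diagonal hR
  refine ⟨hspec, ?_⟩
  change (shapeMatrix ρ Φ p η).trace = _ at htr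
  change (shapeMatrix ρ Φ p η).det = _ at hdet
  rw [skewCurvature, meanCurvature, gaussCurvature, htr, hdet]
  have : ((k + l) / 2) ^ 2 - (k * l + ρ) + ρ = (|k - l| / 2) ^ 2 := by
    rw [div_pow |k - l|, sq_abs]; ring
  rw [this, Real.sqrt_sq (by positivity)]
  ring

variable [IsManifold (𝓡 2) ∞ N]

/-- A straight line in the chart. It realizes tangent vectors as velocities, so that equivariance
can be differentiated along curves. -/
theorem exists_curve_of_coordinates (hΦ : ContMDiff (𝓡 2) 𝓘(ℝ, V4) ∞ Φ) (p : N)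
    (a : EuclideanSpace ℝ (Fin 2)) :
    ∃ c : ℝ → N, ContMDiffAt 𝓘(ℝ, ℝ) (𝓡 2) ∞ c 0 ∧ c 0 = p ∧
      HasDerivAt (fun s => Φ (c s)) (fderiv ℝ (localRep Φ p) (extChartAt (𝓡 2) p p) a) 0 := by
  set u := fun t : ℝ => extChartAt (𝓡 2) p p + t • a with hu_def
  have hu0 : u 0 = extChartAt (𝓡 2) p p := by simp [u]
  have hus : ContDiff ℝ ∞ u := contDiff_const.add (contDiff_id.smul contDiff_const)
  have hu : HasDerivAt u a 0 := by
    have := ((hasDerivAt_id (0 : ℝ)).smul_const a).const_add (extChartAt (𝓡 2) p p)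
    rwa [one_smul] at this
  refine ⟨fun t => (extChartAt (𝓡 2) p).symm (u t), ?_, ?_, ?_⟩
  · have h1 : ContMDiffAt 𝓘(ℝ, EuclideanSpace ℝ (Fin 2)) (𝓡 2) ∞ (extChartAt (𝓡 2) p).symm
        (u 0) := by
      rw [hu0]
      exact (contMDiffOn_extChartAt_symm p).contMDiffAt (extChartAt_target_mem_nhds p)
    exact h1.comp 0 hus.contMDiff.contMDiffAt
  · change (extChartAt (𝓡 2) p).symm (u 0) = p
    rw [hu0, extChartAt_to_inv]
  · have h1 : HasFDerivAt (localRep Φ p) (fderiv ℝ (localRep Φ p) (extChartAt (𝓡 2) p p))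
        (u 0) := by
      rw [hu0]
      exact ((contDiffAt_localRep hΦ p).differentiableAt (by simp)).hasFDerivAt
    exact h1.comp_hasDerivAt 0 hu

/-- The second fundamental form in the direction of a curve `c`. -/
theorem secondForm_curve (hΦ : ContMDiff (𝓡 2) 𝓘(ℝ, V4) ∞ Φ) {p : N} {c : ℝ → N}
    (hc : ContMDiffAt 𝓘(ℝ, ℝ) (𝓡 2) ∞ c 0) (hp : c 0 = p) {η : V4}
    (hη : ∀ w ∈ tangentRange Φ p, form ρ w η = 0) :
    ∃ a : EuclideanSpace ℝ (Fin 2),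
      HasDerivAt (fun s => Φ (c s)) (fderiv ℝ (localRep Φ p) (extChartAt (𝓡 2) p p) a) 0 ∧
      HasDerivAt (fun r => form ρ (deriv (fun s => Φ (c s)) r) η)
        (form ρ (fderiv ℝ (fderiv ℝ (localRep Φ p)) (extChartAt (𝓡 2) p p) a a) η) 0 := by
  obtain ⟨-, hev⟩ := curve_in_chart (hc.mdifferentiableAt (by simp)) hp
  set u := fun s => extChartAt (𝓡 2) p (c s) with hudef
  have hut : u 0 = extChartAt (𝓡 2) p p := by rw [hudef, ← hp]
  have hus : ContDiffAt ℝ ∞ u 0 := by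
    rw [← contMDiffAt_iff_contDiffAt]
    have h1 : ContMDiffAt (𝓡 2) 𝓘(ℝ, EuclideanSpace ℝ (Fin 2)) ∞ (extChartAt (𝓡 2) p) (c 0) := by
      rw [hp]; exact contMDiffAt_extChartAt
    exact h1.comp 0 hc
  have hdu : ∀ᶠ r in 𝓝 (0 : ℝ), DifferentiableAt ℝ u r := by
    filter_upwards [(hus.of_le (m := 1) (by norm_cast)).eventually (by simp)] with r hr
    exact hr.differentiableAt (by simp)
  have hdF : ∀ᶠ r in 𝓝 (0 : ℝ), DifferentiableAt ℝ (localRep Φ p) (u r) := by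
    have h1 : ∀ᶠ x in 𝓝 (u 0), DifferentiableAt ℝ (localRep Φ p) x := by
      rw [hut]
      filter_upwards [((contDiffAt_localRep hΦ p).of_le (m := 1) (by norm_cast)).eventually
        (by simp)] with x hx
      exact hx.differentiableAt (by simp)
    exact hus.continuousAt.eventually h1
  have heq : (fun s => Φ (c s)) =ᶠ[𝓝 0] fun s => localRep Φ p (u s) := by
    filter_upwards [hev] with s hs
    exact congrArg Φ hs.2.symm
  have hderiv : deriv (fun s => Φ (c s)) =ᶠ[𝓝 0]
      fun s => fderiv ℝ (localRep Φ p) (u s) (deriv u s) := by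
    refine heq.deriv.trans ?_
    filter_upwards [hdu, hdF] with s h1 h2
    exact (h2.hasFDerivAt.comp_hasDerivAt s h1.hasDerivAt).deriv
  have hu' : DifferentiableAt ℝ (deriv u) 0 := by
    have h1 : ContDiffAt ℝ ∞ (fun s => fderiv ℝ u s 1) 0 :=
      (hus.fderiv_right (m := ∞) (by simp)).clm_apply contDiffAt_const
    exact h1.differentiableAt (by simp)
  refine ⟨deriv u 0, ?_, ?_⟩
  · rw [← hut]
    exact (hdF.self_of_nhds.hasFDerivAt.comp_hasDerivAt 0
      hdu.self_of_nhds.hasDerivAt).congr_of_eventuallyEq heq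
  · have h1 : HasFDerivAt (fderiv ℝ (localRep Φ p))
        (fderiv ℝ (fderiv ℝ (localRep Φ p)) (u 0)) (u 0) := by
      rw [hut]
      exact ((contDiffAt_fderiv_localRep hΦ p).differentiableAt (by simp)).hasFDerivAt
    have h2 := (h1.comp_hasDerivAt 0 hdu.self_of_nhds.hasDerivAt).clm_apply hu'.hasDerivAt
    have h3 := hasDerivAt_form (ρ := ρ) (h2.congr_of_eventuallyEq hderiv) (hasDerivAt_const 0 η)
    -- The acceleration in coordinates contributes only a tangent vector, invisible to `η`.
    have h4 : form ρ (fderiv ℝ (localRep Φ p) (extChartAt (𝓡 2) p p) (deriv (deriv u) 0)) η = 0 := by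
      apply hη
      have := fderiv_localRep_mem hΦ p (mem_extChartAt_target (I := 𝓡 2) p) (deriv (deriv u) 0)
      rwa [extChartAt_to_inv] at this
    refine h3.congr_deriv ?_
    rw [form_zero_right, add_zero, form_add_left, Function.comp_apply, hut, h4, add_zero]

end Surface

/-! ### Equivariance and tangent planes. -/

section Action

open Filter Topology

variable {N : Type*} [TopologicalSpace N] [ChartedSpace (EuclideanSpace ℝ (Fin 2)) N]
  [IsManifold (𝓡 2) ∞ N] {ρ : ℝ} {Φ : N → V4} {φ : ℝ → V4 →ᵃ[ℝ] V4} {B : V4 →ₗ[ℝ] V4} {o : V4}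
  {τ : ℝ → N → N}

omit [IsManifold (𝓡 2) ∞ N] in
theorem contMDiff_action_right
    (hτ : ContMDiff (𝓘(ℝ, ℝ).prod (𝓡 2)) (𝓡 2) ∞ (fun q : ℝ × N => τ q.1 q.2)) (t : ℝ) :
    ContMDiff (𝓡 2) (𝓡 2) ∞ (τ t) :=
  hτ.comp (contMDiff_const.prodMk contMDiff_id)

omit [IsManifold (𝓡 2) ∞ N] in
theorem contMDiff_action_left
    (hτ : ContMDiff (𝓘(ℝ, ℝ).prod (𝓡 2)) (𝓡 2) ∞ (fun q : ℝ × N => τ q.1 q.2)) (q : N) :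
    ContMDiff 𝓘(ℝ, ℝ) (𝓡 2) ∞ (fun t => τ t q) :=
  hτ.comp (contMDiff_id.prodMk contMDiff_const)

theorem hasDerivAt_affine_comp {E : Type*} [NormedAddCommGroup E] [NormedSpace ℝ E]
    [FiniteDimensional ℝ E] (A : E →ᵃ[ℝ] E) {f : ℝ → E} {f' : E} {t : ℝ}
    (hf : HasDerivAt f f' t) : HasDerivAt (fun s => A (f s)) (A.linear f') t := by
  have h1 : (fun s => A (f s)) = fun s => LinearMap.toContinuousLinearMap A.linear (f s) + A 0 := by
    funext s
    exact congrFun A.decomp (f s)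
  rw [h1]
  exact ((LinearMap.toContinuousLinearMap A.linear).hasFDerivAt.comp_hasDerivAt t hf).add_const _

/-- The derivative of `Φ ∘ τ t = φ t ∘ Φ` along a curve with velocity `v`. -/
theorem linear_mem_tangentRange (hΦ : ContMDiff (𝓡 2) 𝓘(ℝ, V4) ∞ Φ)
    (hτ : ContMDiff (𝓘(ℝ, ℝ).prod (𝓡 2)) (𝓡 2) ∞ (fun q : ℝ × N => τ q.1 q.2))
    (heq : ∀ t p, Φ (τ t p) = φ t (Φ p)) (t : ℝ) {q : N} {v : V4} (hv : v ∈ tangentRange Φ q) :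
    (φ t).linear v ∈ tangentRange Φ (τ t q) := by
  have hd : ∀ q, MDifferentiableAt (𝓡 2) 𝓘(ℝ, V4) Φ q := fun q =>
    hΦ.mdifferentiableAt (by simp)
  obtain ⟨a, rfl⟩ := (mem_tangentRange_iff (hd q)).1 hv
  rw [← fderiv_localRep_apply]
  obtain ⟨c, hc, rfl, hcd⟩ := exists_curve_of_coordinates hΦ q a
  obtain ⟨w, hw, hwd⟩ := hasDerivAt_comp_curve (hd (τ t (c 0)))
    (((contMDiff_action_right hτ t).mdifferentiableAt (by simp)).comp 0
      (hc.mdifferentiableAt (by simp))) rfl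
  have h1 := hasDerivAt_affine_comp (φ t) hcd
  simp only [← heq] at h1
  rwa [h1.unique hwd]

end Action

/-! ### The surface does not meet the zeros of the Killing field. -/

section Axis

open Filter Topology

variable {N : Type*} [TopologicalSpace N] [ChartedSpace (EuclideanSpace ℝ (Fin 2)) N]
  [IsManifold (𝓡 2) ∞ N] {ρ : ℝ} {Φ : N → V4} {φ : ℝ → V4 →ᵃ[ℝ] V4} {B : V4 →ₗ[ℝ] V4} {o : V4}
  {τ : ℝ → N → N}

omit [IsManifold (𝓡 2) ∞ N] in
theorem fderiv_localRep_injective (hΦ : IsImmersedSurface ρ Φ) (p : N) :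
    Function.Injective (fderiv ℝ (localRep Φ p) (extChartAt (𝓡 2) p p)) := by
  rw [← mfderiv_eq_fderiv_localRep (hΦ.smooth.mdifferentiableAt (by simp))]
  exact hΦ.immersion p

omit [IsManifold (𝓡 2) ∞ N] in
theorem exists_leftInverse_fderiv_localRep (hΦ : IsImmersedSurface ρ Φ) (p : N) :
    ∃ L : V4 →L[ℝ] EuclideanSpace ℝ (Fin 2),
      ∀ a, L (fderiv ℝ (localRep Φ p) (extChartAt (𝓡 2) p p) a) = a := by
  obtain ⟨L, hL⟩ := LinearMap.exists_leftInverse_of_injective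
    (fderiv ℝ (localRep Φ p) (extChartAt (𝓡 2) p p)).toLinearMap
    (LinearMap.ker_eq_bot.2 (fderiv_localRep_injective hΦ p))
  exact ⟨LinearMap.toContinuousLinearMap L, fun a => LinearMap.congr_fun hL a⟩

/-- A continuous curve of the surface on which the immersion is constant is locally constant. -/
theorem eventually_eq_of_comp_eq (hΦ : IsImmersedSurface ρ Φ) {c : ℝ → N} {t : ℝ}
    (hc : ContinuousAt c t) (h : ∀ s, Φ (c s) = Φ (c t)) : ∀ᶠ s in 𝓝 t, c s = c t := by
  set p := c t with hp
  obtain ⟨L, hL⟩ := exists_leftInverse_fderiv_localRep hΦ p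
  have h1 : HasStrictFDerivAt (localRep Φ p)
      (fderiv ℝ (localRep Φ p) (extChartAt (𝓡 2) p p)) (extChartAt (𝓡 2) p p) :=
    (contDiffAt_localRep hΦ.smooth p).hasStrictFDerivAt (by simp)
  -- Composed with a left inverse of its differential, the immersion has derivative the identity, so
  -- the inverse function theorem makes it injective near `p`.
  have h2 : HasStrictFDerivAt (fun u => L (localRep Φ p u))
      (ContinuousLinearEquiv.refl ℝ (EuclideanSpace ℝ (Fin 2)) :
        EuclideanSpace ℝ (Fin 2) →L[ℝ] EuclideanSpace ℝ (Fin 2)) (extChartAt (𝓡 2) p p) := by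
    refine (L.hasStrictFDerivAt.comp _ h1).congr_fderiv ?_
    ext1 a
    exact hL a
  have hcc : ContinuousAt (fun s => extChartAt (𝓡 2) p (c s)) t :=
    ContinuousAt.comp (g := extChartAt (𝓡 2) p) (by rw [← hp]; exact continuousAt_extChartAt p) hc
  have h3 : ∀ᶠ s in 𝓝 t,
      extChartAt (𝓡 2) p (c s) ∈ (h2.toOpenPartialHomeomorph _).source :=
    hcc.preimage_mem_nhds ((h2.toOpenPartialHomeomorph _).open_source.mem_nhds
      h2.mem_toOpenPartialHomeomorph_source)
  have h4 : ∀ᶠ s in 𝓝 t, c s ∈ (extChartAt (𝓡 2) p).source :=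
    hc.preimage_mem_nhds (extChartAt_source_mem_nhds p)
  filter_upwards [h3, h4] with s hs3 hs4
  refine (extChartAt (𝓡 2) p).injOn hs4 (mem_extChartAt_source p) ?_
  refine (h2.toOpenPartialHomeomorph _).injOn hs3 h2.mem_toOpenPartialHomeomorph_source ?_
  change L (Φ _) = L (Φ _)
  rw [(extChartAt (𝓡 2) p).left_inv hs4, extChartAt_to_inv, h s]

/-- Gram–Schmidt applied to the two partial derivatives; the ambient form may be Lorentzian, but it
is positive on vectors tangent to the space form. -/
theorem exists_orthonormal_tangentRange (hΦ : IsImmersedSurface ρ Φ) (p : N) :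
    ∃ e₁ ∈ tangentRange Φ p, ∃ e₂ ∈ tangentRange Φ p, form ρ e₁ e₁ = 1 ∧ form ρ e₂ e₂ = 1 ∧
      form ρ e₁ e₂ = 0 ∧ ∀ w ∈ tangentRange Φ p, w = form ρ w e₁ • e₁ + form ρ w e₂ • e₂ := by
  have hd : MDifferentiableAt (𝓡 2) 𝓘(ℝ, V4) Φ p := hΦ.smooth.mdifferentiableAt (by simp)
  set x := partialRep Φ p 0 (extChartAt (𝓡 2) p p)
  set y := partialRep Φ p 1 (extChartAt (𝓡 2) p p)
  have hx : x ∈ tangentRange Φ p := partialRep_mem_tangentRange hd 0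
  have hy : y ∈ tangentRange Φ p := partialRep_mem_tangentRange hd 1
  have hli : ∀ a b : ℝ, a • x + b • y = 0 → a = 0 ∧ b = 0 := fun a b hab => by
    have h1 : fderiv ℝ (localRep Φ p) (extChartAt (𝓡 2) p p) (!₂[a, b]) =
        fderiv ℝ (localRep Φ p) (extChartAt (𝓡 2) p p) 0 := by
      rw [fderiv_localRep_apply, map_zero, Fin.sum_univ_two]
      exact hab
    have h2 := fderiv_localRep_injective hΦ p h1
    exact ⟨by simpa using congrArg (fun u => u.ofLp 0) h2,
      by simpa using congrArg (fun u => u.ofLp 1) h2⟩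
  have hpos : ∀ v ∈ tangentRange Φ p, v ≠ 0 → 0 < form ρ v v := fun v hv hne =>
    form_self_pos_of_isTangent (hΦ.mem p)
      (isTangent_iff.2 (modelNormal_orthogonal_tangentRange hΦ hv)) hne
  have hnorm : ∀ v ∈ tangentRange Φ p, v ≠ 0 → ∃ r : ℝ, r ≠ 0 ∧ form ρ (r • v) (r • v) = 1 :=
    fun v hv hne => by
      have h1 := hpos v hv hne
      refine ⟨(√(form ρ v v))⁻¹, (inv_pos.2 (Real.sqrt_pos.2 h1)).ne', ?_⟩
      rw [form_smul_left, form_smul_right, ← mul_assoc, ← mul_inv, Real.mul_self_sqrt h1.le,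
        inv_mul_cancel₀ h1.ne']
  have hx0 : x ≠ 0 := fun h => one_ne_zero (hli 1 0 (by simp [h])).1
  obtain ⟨r, hr, hr1⟩ := hnorm x hx hx0
  set k := form ρ y x / form ρ x x
  have hz : y - k • x ∈ tangentRange Φ p := sub_mem hy (Submodule.smul_mem _ _ hx)
  have hz0 : y - k • x ≠ 0 := fun h =>
    one_ne_zero (hli (-k) 1 (by rw [← h]; module)).2
  obtain ⟨q, hq, hq1⟩ := hnorm _ hz hz0
  have hort : form ρ (r • x) (q • (y - k • x)) = 0 := by
    rw [form_smul_left, form_smul_right, form_sub_right, form_smul_right, form_comm ρ x y,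
      div_mul_cancel₀ _ (hpos x hx hx0).ne']
    ring
  refine ⟨r • x, Submodule.smul_mem _ _ hx, q • (y - k • x), Submodule.smul_mem _ _ hz, hr1, hq1,
    hort, fun w hw => ?_⟩
  obtain ⟨a, rfl⟩ := (mem_tangentRange_iff hd).1 hw
  have hspan : ∃ s t : ℝ, ∑ i, a i • partialRep Φ p i (extChartAt (𝓡 2) p p) =
      s • (r • x) + t • (q • (y - k • x)) := by
    refine ⟨(a 0 + a 1 * k) * r⁻¹, a 1 * q⁻¹, ?_⟩
    rw [smul_smul, smul_smul, inv_mul_cancel_right₀ hr, inv_mul_cancel_right₀ hq,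
      Fin.sum_univ_two]
    change a 0 • x + a 1 • y = _
    module
  obtain ⟨s, t, hst⟩ := hspan
  rw [hst]
  generalize r • x = e₁ at hr1 hort
  generalize q • (y - k • x) = e₂ at hq1 hort
  simp only [form_add_left, form_smul_left, hr1, hq1, hort, form_comm ρ e₂ e₁]
  simp

/-- A surface of positive constant skew curvature does not meet the axis of rotation. -/
theorem killing_ne_zero_of_skewCurvature (hΦ : IsImmersedSurface ρ Φ) (hφ : IsRotationGroup ρ φ)
    (hB : IsGenerator ρ φ B o) (hτ0 : ∀ p, τ 0 p = p)
    (hτ : ContMDiff (𝓘(ℝ, ℝ).prod (𝓡 2)) (𝓡 2) ∞ (fun q : ℝ × N => τ q.1 q.2))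
    (heq : ∀ t p, Φ (τ t p) = φ t (Φ p)) {c : ℝ} (hc : 0 < c)
    (hskew : HasConstantSkewCurvature ρ Φ c) (p : N) : B (Φ p - o) ≠ 0 := by
  intro hBp
  have hfix : ∀ v, B v = 0 → ∀ t, (φ t).linear v = v := fun v hv t => by
    have h1 : ∀ s, HasDerivAt (fun s => (φ s).linear v) 0 s := fun s => by
      simpa [hv] using hB.hasDerivAt_linear v s
    rw [is_const_of_deriv_eq_zero (fun s => (h1 s).differentiableAt) (fun s => (h1 s).deriv) t 0,
      IsGenerator.linear_zero hφ]
  have hΦp : ∀ t, φ t (Φ p) = Φ p := fun t => by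
    rw [hB.apply_eq, hfix _ hBp]; abel
  -- The group fixes `Φ p`; as `Φ` is only an immersion, `p` itself is seen to be fixed for small
  -- `t`, which suffices for differentiating at `0`.
  have hτp : ∀ᶠ t in 𝓝 (0 : ℝ), τ t p = p := by
    have h1 := eventually_eq_of_comp_eq hΦ (c := fun t => τ t p) (t := 0)
      (contMDiff_action_left hτ p).continuous.continuousAt
      (fun s => by rw [heq, heq, hΦp, hΦp])
    simpa only [hτ0] using h1
  obtain ⟨L, hL⟩ := exists_leftInverse_fderiv_localRep hΦ p
  set D := fderiv ℝ (localRep Φ p) (extChartAt (𝓡 2) p p) with hD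
  have hd : MDifferentiableAt (𝓡 2) 𝓘(ℝ, V4) Φ p := hΦ.smooth.mdifferentiableAt (by simp)
  have hmem : ∀ v, v ∈ tangentRange Φ p ↔ ∃ a, D a = v := fun v => by
    rw [mem_tangentRange_iff hd]; simp only [← fderiv_localRep_apply, hD]
  have hLmem : ∀ v ∈ tangentRange Φ p, D (L v) = v := fun v hv => by
    obtain ⟨a, rfl⟩ := (hmem v).1 hv
    rw [hL]
  have hlin : ∀ v, HasDerivAt (fun t => (φ t).linear v) (B v) 0 := fun v => by
    simpa [IsGenerator.linear_zero hφ] using hB.hasDerivAt_linear v 0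
  have hBmem : ∀ v ∈ tangentRange Φ p, B v ∈ tangentRange Φ p := fun v hv => by
    have h1 : (fun t => D (L ((φ t).linear v))) =ᶠ[𝓝 0] fun t => (φ t).linear v := by
      filter_upwards [hτp] with t ht
      apply hLmem
      have := linear_mem_tangentRange hΦ.smooth hτ heq t hv
      rwa [ht] at this
    have h2 : HasDerivAt (fun t => D (L ((φ t).linear v))) (D (L (B v))) 0 :=
      (D.comp L).hasFDerivAt.comp_hasDerivAt 0 (hlin v)
    have h3 := h2.unique ((hlin v).congr_of_eventuallyEq h1)
    exact (hmem _).2 ⟨_, h3⟩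
  obtain ⟨e₁, he₁, e₂, he₂, h11, h22, h12, hexp⟩ := exists_orthonormal_tangentRange hΦ p
  set x := modelNormal ρ (Φ p) with hx
  have hx1 : form ρ x e₁ = 0 := modelNormal_orthogonal_tangentRange hΦ he₁
  have hx2 : form ρ x e₂ = 0 := modelNormal_orthogonal_tangentRange hΦ he₂
  have hxx : form ρ x x ≠ 0 := form_modelNormal_self_ne (hΦ.mem p)
  have hBx : B x = 0 := by
    by_cases hρ : ρ = 0
    · rw [hx, modelNormal, if_pos hρ]; exact hB.map_single hρ
    · rw [hx, modelNormal, if_neg hρ]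
      rwa [hB.base_eq_zero hρ, sub_zero] at hBp
  set η := crossScale ρ • cross ρ x e₁ e₂ with hη
  have hηη : form ρ η η = 1 := form_crossScale_smul_cross (hΦ.mem p) hx1 hx2 h12 h11 h22
  have hηx : form ρ x η = 0 := by
    rw [form_comm, hη, form_smul_left, form_cross_fst, mul_zero]
  have hη1 : form ρ e₁ η = 0 := by
    rw [form_comm, hη, form_smul_left, form_cross_snd, mul_zero]
  have hη2 : form ρ e₂ η = 0 := by
    rw [form_comm, hη, form_smul_left, form_cross_trd, mul_zero]
  have hηP : ∀ w ∈ tangentRange Φ p, form ρ w η = 0 := fun w hw => by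
    rw [hexp w hw, form_add_left, form_smul_left, form_smul_left, hη1, hη2]; ring
  have hframe := eq_add_of_orthogonal_frame (ρ := ρ) hxx (h11 ▸ one_ne_zero) (h22 ▸ one_ne_zero)
    (hηη ▸ one_ne_zero) hx1 hx2 hηx h12 hη1 hη2
  -- `B` kills `x` and preserves the tangent plane, so by skewness `B η` is orthogonal to the whole
  -- frame. Hence `B` acts only on the tangent plane, as an infinitesimal rotation of speed `θ ≠ 0`.
  have hBη : B η = 0 := by
    rw [hframe (B η), hB.skew η x, hB.skew η e₁, hB.skew η e₂, hB.form_map_self, hBx,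
      form_zero_right, form_comm ρ η (B e₁), form_comm ρ η (B e₂), hηP _ (hBmem _ he₁),
      hηP _ (hBmem _ he₂)]
    simp
  set θ := form ρ (B e₁) e₂ with hθ
  have hθ' : form ρ (B e₂) e₁ = -θ := by rw [hB.skew, form_comm]
  have hBe1 : B e₁ = θ • e₂ := by
    rw [hexp _ (hBmem _ he₁), hB.form_map_self, zero_smul, zero_add]
  have hBe2 : B e₂ = -θ • e₁ := by
    rw [hexp _ (hBmem _ he₂), hB.form_map_self, zero_smul, add_zero, hθ']
  have hθ0 : θ ≠ 0 := fun h0 => by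
    apply hB.ne_zero
    refine LinearMap.ext fun y => ?_
    rw [hframe y]
    simp [hBx, hBη, hBe1, hBe2, h0]
  set b : EuclideanSpace ℝ (Fin 2) → EuclideanSpace ℝ (Fin 2) → ℝ := fun u v =>
    form ρ (fderiv ℝ (fderiv ℝ (localRep Φ p)) (extChartAt (𝓡 2) p p) u v) η with hb
  have hbsymm : ∀ u v, b u v = b v u := fun u v => by
    have := (contDiffAt_localRep hΦ.smooth p).isSymmSndFDerivAt
      (by rw [minSmoothness_of_isRCLikeNormedField]; norm_cast) u v
    simp only [hb, this]
  -- The second fundamental form `b` is invariant under the linearized action, because `φ t` fixes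
  -- `η`. Differentiating `b(φ_t u, φ_t u) = b(u, u)` at `t = 0` gives `2 b(u, v) = 0`.
  have hinv : ∀ u v, D v = B (D u) → b u v = 0 := fun u v huv => by
    have h1 : ∀ᶠ t in 𝓝 (0 : ℝ), b (L ((φ t).linear (D u))) (L ((φ t).linear (D u))) = b u u := by
      obtain ⟨γ, hγ, hγ0, hγd⟩ := exists_curve_of_coordinates hΦ.smooth p u
      obtain ⟨u', hu', hu''⟩ := secondForm_curve hΦ.smooth hγ hγ0 hηP
      have huu : u' = u := fderiv_localRep_injective hΦ p (hu'.unique hγd)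
      rw [huu] at hu''
      have hγdiff : ∀ᶠ r in 𝓝 (0 : ℝ), DifferentiableAt ℝ (fun s => Φ (γ s)) r := by
        have h1 : ContDiffAt ℝ 1 (fun s => Φ (γ s)) 0 := by
          rw [← contMDiffAt_iff_contDiffAt]
          exact ((hΦ.smooth.contMDiffAt.comp 0 hγ).of_le (by norm_cast))
        filter_upwards [h1.eventually (by simp)] with r hr
        exact hr.differentiableAt (by simp)
      filter_upwards [hτp] with t ht
      have hγt : ContMDiffAt 𝓘(ℝ, ℝ) (𝓡 2) ∞ (fun s => τ t (γ s)) 0 :=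
        (contMDiff_action_right hτ t).contMDiffAt.comp 0 hγ
      obtain ⟨w, hw, hw'⟩ := secondForm_curve hΦ.smooth hγt (by rw [hγ0, ht]) hηP
      have h2 : D w = (φ t).linear (D u) := by
        simp only [heq] at hw
        exact hw.unique (hasDerivAt_affine_comp (φ t) hγd)
      rw [← h2, hL]
      refine hw'.unique (hu''.congr_of_eventuallyEq ?_)
      filter_upwards [hγdiff] with r hr
      simp only [heq]
      rw [(hasDerivAt_affine_comp (φ t) hr.hasDerivAt).deriv, ← hfix η hBη t, hφ.preserves_form,
        hfix η hBη t]
    have h2 : HasDerivAt (fun t => L ((φ t).linear (D u))) v 0 := by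
      have := L.hasFDerivAt.comp_hasDerivAt 0 (hlin (D u))
      rwa [← huv, hL] at this
    have h3 := ((fderiv ℝ (fderiv ℝ (localRep Φ p))
      (extChartAt (𝓡 2) p p)).hasFDerivAt.comp_hasDerivAt 0 h2).clm_apply h2
    have h4 := hasDerivAt_form (ρ := ρ) h3 (hasDerivAt_const 0 η)
    have h5 := (h4.congr_of_eventuallyEq (EventuallyEq.symm h1)).unique (hasDerivAt_const _ _)
    simp only [Function.comp_apply, IsGenerator.linear_zero hφ, hL, form_zero_right, add_zero,
      form_add_left] at h5
    have h6 : b v u + b u v = 0 := h5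
    rw [hbsymm v u] at h6
    linarith
  obtain ⟨u₁, hu₁⟩ := (hmem _).1 he₁
  obtain ⟨u₂, hu₂⟩ := (hmem _).1 he₂
  have badd : ∀ u v w, b (u + v) w = b u w + b v w := fun u v w => by
    simp only [hb, map_add, add_apply, form_add_left]
  have bsmul : ∀ (r : ℝ) u w, b (r • u) w = r * b u w := fun r u w => by
    simp only [hb, map_smul, smul_apply, form_smul_left]
  have badd' : ∀ u v w, b u (v + w) = b u v + b u w := fun u v w => by
    simp only [hb, map_add, form_add_left]
  have bsmul' : ∀ (r : ℝ) u w, b u (r • w) = r * b u w := fun r u w => by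
    simp only [hb, map_smul, form_smul_left]
  -- Infinitesimal invariance applied to `u₁` and to `u₁ + u₂` makes `b` a multiple of the metric:
  -- `p` is umbilic.
  have hb12 : b u₁ u₂ = 0 := by
    have h1 := hinv u₁ (θ • u₂) (by rw [map_smul, hu₁, hu₂, hBe1])
    rw [bsmul'] at h1
    exact (mul_eq_zero.1 h1).resolve_left hθ0
  have hb22 : b u₂ u₂ = b u₁ u₁ := by
    have h1 := hinv (u₁ + u₂) (θ • u₂ + -θ • u₁) (by
      rw [map_add, map_add, map_add, map_smul, map_smul, hu₁, hu₂, hBe1, hBe2])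
    rw [badd', bsmul', bsmul', badd, badd, hb12, hbsymm u₂ u₁, hb12] at h1
    have h2 : θ * (b u₂ u₂ - b u₁ u₁) = 0 := by linarith
    exact sub_eq_zero.1 ((mul_eq_zero.1 h2).resolve_left hθ0)
  have hsecond : ∀ i j, secondForm ρ Φ p η i j =
      b (EuclideanSpace.single i 1) (EuclideanSpace.single j 1) := fun i j => by
    simp only [secondForm, Matrix.of_apply, fderiv_partialRep_apply hΦ.smooth, hb]
  have hsum : ∀ (u : EuclideanSpace ℝ (Fin 2)) j, ∑ i, u i * secondForm ρ Φ p η i j =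
      b u (EuclideanSpace.single j 1) := fun u j => by
    simp only [hsecond, ← bsmul, Fin.sum_univ_two, ← badd]
    congr 1
    ext i
    fin_cases i <;> simp
  have hsingle : ∀ j : Fin 2, (EuclideanSpace.single j (1 : ℝ)) =
      form ρ (partialRep Φ p j (extChartAt (𝓡 2) p p)) e₁ • u₁ +
        form ρ (partialRep Φ p j (extChartAt (𝓡 2) p p)) e₂ • u₂ := fun j => by
    apply fderiv_localRep_injective hΦ p
    change D _ = D _
    rw [map_add, map_smul, map_smul, hu₁, hu₂]
    exact hexp _ (partialRep_mem_tangentRange hd j)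
  have hD' : ∀ u : EuclideanSpace ℝ (Fin 2),
      ∑ i, u i • partialRep Φ p i (extChartAt (𝓡 2) p p) = D u := fun u =>
    (fderiv_localRep_apply Φ p _ u).symm
  obtain ⟨-, hS⟩ := curvatures_of_principal_directions (ρ := ρ) (Φ := Φ) (p := p) (η := η)
    (k := b u₁ u₁) (l := b u₁ u₁) ((hD' u₁).trans hu₁) ((hD' u₂).trans hu₂)
    (h11 ▸ one_ne_zero) (h22 ▸ one_ne_zero) h12
    (fun j => by
      rw [hsum, hsingle j, badd', bsmul', bsmul', hb12, form_comm ρ e₁]; ring)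
    (fun j => by
      rw [hsum, hsingle j, badd', bsmul', bsmul', hbsymm u₂ u₁, hb12, hb22, form_comm ρ e₂]; ring)
  have hunit : IsUnitNormal ρ Φ p η :=
    (isUnitNormal_iff hΦ.smooth).2 ⟨hηη, isTangent_iff.2 hηx, hηP⟩
  rw [hskew p η hunit] at hS
  simp at hS
  exact hc.ne' hS

end Axis

/-! ### Profile curves in the ambient space: Frenet frame, Gauss and Codazzi equations. -/

section Meridian

open Filter Topology

variable {ρ : ℝ} {φ : ℝ → V4 →ᵃ[ℝ] V4} {B : V4 →ₗ[ℝ] V4} {o : V4} {I : Set ℝ} {α : ℝ → V4}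

/-- A unit speed curve of the space form orthogonal to a Killing field `B (x - o)` which does not
vanish along the curve. -/
structure IsMeridian (ρ : ℝ) (B : V4 →ₗ[ℝ] V4) (o : V4) (I : Set ℝ) (α : ℝ → V4) : Prop where
  isOpen : IsOpen I
  ordConnected : I.OrdConnected
  smooth : ContDiffOn ℝ ∞ α I
  mem : ∀ s ∈ I, α s ∈ spaceForm ρ
  unit_speed : ∀ s ∈ I, form ρ (deriv α s) (deriv α s) = 1
  tangent : ∀ s ∈ I, form ρ (modelNormal ρ (α s)) (deriv α s) = 0
  killing_tangent : ∀ s ∈ I, form ρ (modelNormal ρ (α s)) (B (α s - o)) = 0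
  killing_orthogonal : ∀ s ∈ I, form ρ (B (α s - o)) (deriv α s) = 0
  killing_ne_zero : ∀ s ∈ I, B (α s - o) ≠ 0

theorem contDiffOn_deriv_of_isOpen {E : Type*} [NormedAddCommGroup E] [NormedSpace ℝ E]
    {f : ℝ → E} (hI : IsOpen I) (hf : ContDiffOn ℝ ∞ f I) : ContDiffOn ℝ ∞ (deriv f) I :=
  hf.deriv_of_isOpen hI (by simp)

theorem hasDerivAt_of_contDiffOn {E : Type*} [NormedAddCommGroup E] [NormedSpace ℝ E]
    {f : ℝ → E} (hI : IsOpen I) (hf : ContDiffOn ℝ ∞ f I) {s : ℝ} (hs : s ∈ I) :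
    HasDerivAt f (deriv f s) s :=
  ((hf.contDiffAt (hI.mem_nhds hs)).differentiableAt (by simp)).hasDerivAt

theorem hasDerivAt_eq_zero_of_eqOn_const {f : ℝ → ℝ} {f' a s : ℝ} (hI : IsOpen I) (hs : s ∈ I)
    (hf : ∀ r ∈ I, f r = a) (hd : HasDerivAt f f' s) : f' = 0 := by
  have h1 : f =ᶠ[𝓝 s] fun _ => a := by
    filter_upwards [hI.mem_nhds hs] with r hr using hf r hr
  exact (hd.congr_of_eventuallyEq h1.symm).unique (hasDerivAt_const _ _)

theorem hasDerivAt_linearMap_comp (A : V4 →ₗ[ℝ] V4) {f : ℝ → V4} {f' : V4} {t : ℝ}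
    (hf : HasDerivAt f f' t) : HasDerivAt (fun s => A (f s)) (A f') t :=
  (LinearMap.toContinuousLinearMap A).hasFDerivAt.comp_hasDerivAt t hf

namespace IsMeridian

theorem hasDerivAt (h : IsMeridian ρ B o I α) {s : ℝ} (hs : s ∈ I) :
    HasDerivAt α (deriv α s) s :=
  hasDerivAt_of_contDiffOn h.isOpen h.smooth hs

theorem hasDerivAt_deriv (h : IsMeridian ρ B o I α) {s : ℝ} (hs : s ∈ I) :
    HasDerivAt (deriv α) (deriv (deriv α) s) s :=
  hasDerivAt_of_contDiffOn h.isOpen (contDiffOn_deriv_of_isOpen h.isOpen h.smooth) hs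

theorem hasDerivAt_killing (h : IsMeridian ρ B o I α) {s : ℝ} (hs : s ∈ I) :
    HasDerivAt (fun r => B (α r - o)) (B (deriv α s)) s :=
  hasDerivAt_linearMap_comp B ((h.hasDerivAt hs).sub_const o)

theorem hasDerivAt_modelNormal (h : IsMeridian ρ B o I α) {s : ℝ} (hs : s ∈ I) :
    HasDerivAt (fun r => modelNormal ρ (α r)) (if ρ = 0 then 0 else deriv α s) s := by
  by_cases hρ : ρ = 0
  · simp only [modelNormal, if_pos hρ]
    exact hasDerivAt_const _ _
  · simp only [modelNormal, if_neg hρ]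
    exact h.hasDerivAt hs

theorem contDiffOn_modelNormal (h : IsMeridian ρ B o I α) :
    ContDiffOn ℝ ∞ (fun r => modelNormal ρ (α r)) I := by
  by_cases hρ : ρ = 0
  · simp only [modelNormal, if_pos hρ]
    exact contDiffOn_const
  · simp only [modelNormal, if_neg hρ]
    exact h.smooth

theorem killing_pos (h : IsMeridian ρ B o I α) {s : ℝ} (hs : s ∈ I) :
    0 < form ρ (B (α s - o)) (B (α s - o)) :=
  form_self_pos_of_isTangent (h.mem s hs) (isTangent_iff.2 (h.killing_tangent s hs))
    (h.killing_ne_zero s hs)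

/-- The direction of the Killing field is constant along a meridian. -/
theorem exists_killing_direction (h : IsMeridian ρ B o I α) (hB : IsGenerator ρ φ B o)
    (hne : I.Nonempty) :
    ∃ n : V4, form ρ n n = 1 ∧ ∀ s ∈ I, 0 < form ρ (B (α s - o)) n ∧
      B (α s - o) = form ρ (B (α s - o)) n • n := by
  obtain ⟨s₀, hs₀⟩ := hne
  set Y : ℝ → V4 := fun s => (√(form ρ (B (α s - o)) (B (α s - o))))⁻¹ • B (α s - o) with hY
  have hderiv : ∀ s ∈ I, HasDerivAt Y 0 s := fun s hs => by
    have hX := h.hasDerivAt_killing hs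
    have hpos := h.killing_pos hs
    have hsq := Real.sqrt_pos.2 hpos
    have h1 := (((hasDerivAt_form (ρ := ρ) hX hX).sqrt hpos.ne').inv hsq.ne').smul hX
    refine h1.congr_deriv ?_
    -- `X' = B T` is a multiple `k X` because `T ⊥ X`; then `|X|' = k |X|` and the normalized field
    -- has zero derivative.
    have h2 := hB.map_eq_smul hpos.ne' (h.killing_orthogonal s hs)
    set k := form ρ (B (deriv α s)) (B (α s - o)) / form ρ (B (α s - o)) (B (α s - o))
    rw [h2, form_smul_left, form_smul_right, Pi.inv_apply]
    generalize B (α s - o) = X at hpos hsq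
    have h3 := Real.sq_sqrt hpos.le
    generalize √(form ρ X X) = r at hsq h3
    rw [← h3]
    have : r ≠ 0 := hsq.ne'
    rw [smul_smul, ← add_smul]
    convert zero_smul ℝ X
    field_simp
    ring
  have hconst : ∀ s ∈ I, Y s = Y s₀ := fun s hs =>
    h.isOpen.is_const_of_deriv_eq_zero h.ordConnected.isPreconnected
      (fun r hr => (hderiv r hr).differentiableAt.differentiableWithinAt)
      (fun r hr => (hderiv r hr).deriv) hs hs₀
  have hXY : ∀ s ∈ I, B (α s - o) = √(form ρ (B (α s - o)) (B (α s - o))) • Y s₀ :=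
    fun s hs => by
      rw [← hconst s hs]
      simp only [hY]
      rw [smul_smul, mul_inv_cancel₀ (Real.sqrt_pos.2 (h.killing_pos hs)).ne', one_smul]
  have hunit : form ρ (Y s₀) (Y s₀) = 1 := by
    have hpos := h.killing_pos hs₀
    simp only [hY]
    rw [form_smul_left, form_smul_right, ← mul_assoc, ← mul_inv, Real.mul_self_sqrt hpos.le,
      inv_mul_cancel₀ hpos.ne']
  refine ⟨Y s₀, hunit, fun s hs => ?_⟩
  have h1 : form ρ (B (α s - o)) (Y s₀) = √(form ρ (B (α s - o)) (B (α s - o))) := by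
    conv_lhs => rw [hXY s hs]
    rw [form_smul_left, hunit, mul_one]
  rw [h1]
  exact ⟨Real.sqrt_pos.2 (h.killing_pos hs), hXY s hs⟩

end IsMeridian

/-- A meridian with the constant unit direction `n` of the Killing field and a smooth unit normal
field `ν` orthogonal to `n`. -/
structure IsMeridianFrame (ρ : ℝ) (B : V4 →ₗ[ℝ] V4) (o : V4) (I : Set ℝ) (α : ℝ → V4) (n : V4)
    (ν : ℝ → V4) : Prop extends IsMeridian ρ B o I α where
  unit_n : form ρ n n = 1
  killing_pos_n : ∀ s ∈ I, 0 < form ρ (B (α s - o)) n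
  killing_eq_n : ∀ s ∈ I, B (α s - o) = form ρ (B (α s - o)) n • n
  smooth_normal : ContDiffOn ℝ ∞ ν I
  unit_normal : ∀ s ∈ I, form ρ (ν s) (ν s) = 1
  normal_model : ∀ s ∈ I, form ρ (modelNormal ρ (α s)) (ν s) = 0
  normal_deriv : ∀ s ∈ I, form ρ (deriv α s) (ν s) = 0
  normal_n : ∀ s ∈ I, form ρ n (ν s) = 0

namespace IsMeridianFrame

variable {n : V4} {ν : ℝ → V4}

theorem neg (h : IsMeridianFrame ρ B o I α n ν) : IsMeridianFrame ρ B o I α n (-ν) where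
  toIsMeridian := h.toIsMeridian
  unit_n := h.unit_n
  killing_pos_n := h.killing_pos_n
  killing_eq_n := h.killing_eq_n
  smooth_normal := h.smooth_normal.neg
  unit_normal s hs := by
    rw [Pi.neg_apply, form_neg_left, form_neg_right, neg_neg, h.unit_normal s hs]
  normal_model s hs := by rw [Pi.neg_apply, form_neg_right, h.normal_model s hs, neg_zero]
  normal_deriv s hs := by rw [Pi.neg_apply, form_neg_right, h.normal_deriv s hs, neg_zero]
  normal_n s hs := by rw [Pi.neg_apply, form_neg_right, h.normal_n s hs, neg_zero]

theorem form_n_eq_zero (h : IsMeridianFrame ρ B o I α n ν) {s : ℝ} (hs : s ∈ I) {v : V4}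
    (hv : form ρ (B (α s - o)) v = 0) : form ρ n v = 0 := by
  rw [h.killing_eq_n s hs, form_smul_left] at hv
  exact (mul_eq_zero.1 hv).resolve_left (h.killing_pos_n s hs).ne'

theorem form_n_deriv (h : IsMeridianFrame ρ B o I α n ν) {s : ℝ} (hs : s ∈ I) :
    form ρ n (deriv α s) = 0 :=
  h.form_n_eq_zero hs (h.killing_orthogonal s hs)

theorem form_model_n (h : IsMeridianFrame ρ B o I α n ν) {s : ℝ} (hs : s ∈ I) :
    form ρ (modelNormal ρ (α s)) n = 0 := by
  rw [form_comm]
  apply h.form_n_eq_zero hs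
  rw [form_comm]
  exact h.killing_tangent s hs

theorem expansion (h : IsMeridianFrame ρ B o I α n ν) {s : ℝ} (hs : s ∈ I) (y : V4) :
    y = (form ρ y (modelNormal ρ (α s)) /
          form ρ (modelNormal ρ (α s)) (modelNormal ρ (α s))) • modelNormal ρ (α s)
      + form ρ y (deriv α s) • deriv α s + form ρ y n • n + form ρ y (ν s) • ν s := by
  have := eq_add_of_orthogonal_frame (ρ := ρ) (form_modelNormal_self_ne (h.mem s hs))
    (h.unit_speed s hs ▸ one_ne_zero) (h.unit_n ▸ one_ne_zero) (h.unit_normal s hs ▸ one_ne_zero)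
    (h.tangent s hs) (h.form_model_n hs) (h.normal_model s hs)
    (by rw [form_comm]; exact h.form_n_deriv hs) (h.normal_deriv s hs) (h.normal_n s hs) y
  simpa only [h.unit_speed s hs, h.unit_n, h.unit_normal s hs, div_one] using this

theorem map_deriv (h : IsMeridianFrame ρ B o I α n ν) (hB : IsGenerator ρ φ B o) {s : ℝ}
    (hs : s ∈ I) : B (deriv α s) = form ρ (B (deriv α s)) n • n := by
  have h1 := hB.map_eq_smul (h.killing_pos hs).ne' (h.killing_orthogonal s hs)
  have h2 : ∃ k : ℝ, B (deriv α s) = k • n := by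
    rw [h.killing_eq_n s hs, smul_smul] at h1
    exact ⟨_, h1⟩
  obtain ⟨k, hk⟩ := h2
  rw [hk, form_smul_left, h.unit_n, mul_one]

theorem map_modelNormal (h : IsMeridianFrame ρ B o I α n ν) (hB : IsGenerator ρ φ B o) {s : ℝ}
    (hs : s ∈ I) :
    B (modelNormal ρ (α s)) = if ρ = 0 then 0 else form ρ (B (α s - o)) n • n := by
  by_cases hρ : ρ = 0
  · rw [if_pos hρ, modelNormal, if_pos hρ, hB.map_single hρ]
  · have := h.killing_eq_n s hs
    rw [if_neg hρ, modelNormal, if_neg hρ, ← this, hB.base_eq_zero hρ, sub_zero]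

/-- `B` sends the model normal and the tangent to multiples of `n`, which are orthogonal to `ν`; by
skewness only the `n`-component of `B ν` survives. This makes the orbits principal directions. -/
theorem map_normal (h : IsMeridianFrame ρ B o I α n ν) (hB : IsGenerator ρ φ B o) {s : ℝ}
    (hs : s ∈ I) : B (ν s) = form ρ (B (ν s)) n • n := by
  have h1 : form ρ (B (ν s)) (modelNormal ρ (α s)) = 0 := by
    rw [hB.skew, h.map_modelNormal hB hs]
    split_ifs
    · rw [form_zero_right, neg_zero]
    · rw [form_smul_right, form_comm ρ (ν s) n, h.normal_n s hs, mul_zero, neg_zero]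
  have h2 : form ρ (B (ν s)) (deriv α s) = 0 := by
    rw [hB.skew, h.map_deriv hB hs, form_smul_right, form_comm ρ (ν s) n, h.normal_n s hs, mul_zero,
      neg_zero]
  have h3 := h.expansion hs (B (ν s))
  rw [h1, h2, hB.form_map_self] at h3
  simpa using h3

/-- A Frenet formula: the components of `ν'` are read off by differentiating the orthonormality
relations of `ν`. -/
theorem hasDerivAt_normal (h : IsMeridianFrame ρ B o I α n ν) {s : ℝ} (hs : s ∈ I) :
    HasDerivAt ν (-signedCurvature ρ α ν s • deriv α s) s := by
  have hν := hasDerivAt_of_contDiffOn h.isOpen h.smooth_normal hs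
  refine hν.congr_deriv ?_
  have h1 := hasDerivAt_eq_zero_of_eqOn_const h.isOpen hs
    h.normal_model (hasDerivAt_form (h.hasDerivAt_modelNormal hs) hν)
  have h2 := hasDerivAt_eq_zero_of_eqOn_const h.isOpen hs
    h.normal_deriv (hasDerivAt_form (h.hasDerivAt_deriv hs) hν)
  have h3 := hasDerivAt_eq_zero_of_eqOn_const h.isOpen hs
    h.normal_n (hasDerivAt_form (hasDerivAt_const s n) hν)
  have h4 := hasDerivAt_eq_zero_of_eqOn_const h.isOpen hs
    h.unit_normal (hasDerivAt_form hν hν)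
  have h1' : form ρ (if ρ = 0 then 0 else deriv α s) (ν s) = 0 := by
    split_ifs
    · exact form_zero_left _ _
    · exact h.normal_deriv s hs
  rw [h1', zero_add, form_comm] at h1
  rw [form_zero_left, zero_add, form_comm] at h3
  rw [form_comm ρ (ν s)] at h4
  rw [h.expansion hs (deriv ν s), h1, h3, show form ρ (deriv ν s) (ν s) = 0 by linarith,
    form_comm ρ _ (deriv α s),
    show form ρ (deriv α s) (deriv ν s) = -signedCurvature ρ α ν s by
      rw [signedCurvature]; linarith]
  simp

/-- The other Frenet formula. For `ρ ≠ 0`, differentiating `⟨α, T⟩ = 0` gives `⟨α, α''⟩ = -1`, and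
`⟨α, α⟩ = 1 / ρ` turns this into the coefficient `-ρ`. -/
theorem deriv_deriv_eq (h : IsMeridianFrame ρ B o I α n ν) {s : ℝ} (hs : s ∈ I) :
    deriv (deriv α) s = -ρ • modelNormal ρ (α s) + signedCurvature ρ α ν s • ν s := by
  have hT := h.hasDerivAt_deriv hs
  have h1 := hasDerivAt_eq_zero_of_eqOn_const h.isOpen hs
    h.tangent (hasDerivAt_form (h.hasDerivAt_modelNormal hs) hT)
  have h2 := hasDerivAt_eq_zero_of_eqOn_const h.isOpen hs
    h.unit_speed (hasDerivAt_form hT hT)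
  have h3 := hasDerivAt_eq_zero_of_eqOn_const h.isOpen hs
    (fun r hr => h.form_n_deriv hr)
    (hasDerivAt_form (hasDerivAt_const s n) hT)
  rw [form_zero_left, zero_add, form_comm] at h3
  rw [form_comm ρ (deriv α s)] at h2
  have h4 : form ρ (deriv (deriv α) s) (modelNormal ρ (α s)) /
      form ρ (modelNormal ρ (α s)) (modelNormal ρ (α s)) = -ρ := by
    rw [form_modelNormal_self (h.mem s hs), form_comm]
    by_cases hρ : ρ = 0
    · rw [if_pos hρ, form_zero_left, zero_add] at h1
      rw [h1, hρ]; simp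
    · rw [if_neg hρ, h.unit_speed s hs] at h1
      rw [if_neg hρ, show form ρ (modelNormal ρ (α s)) (deriv (deriv α) s) = -1 by linarith]
      simp
  conv_lhs => rw [h.expansion hs (deriv (deriv α) s)]
  rw [h4, h3, show form ρ (deriv (deriv α) s) (deriv α s) = 0 by linarith]
  simp [signedCurvature]

theorem contDiffOn_signedCurvature (h : IsMeridianFrame ρ B o I α n ν) :
    ContDiffOn ℝ ∞ (signedCurvature ρ α ν) I :=
  contDiffOn_form (contDiffOn_deriv_of_isOpen h.isOpen
    (contDiffOn_deriv_of_isOpen h.isOpen h.smooth)) h.smooth_normal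

/-- The equations of Codazzi and Gauss along a profile curve of a rotational surface whose principal
curvatures differ by `c` yield the Euler-Lagrange equation. -/
theorem satisfiesEulerLagrange (h : IsMeridianFrame ρ B o I α n ν) (hB : IsGenerator ρ φ B o)
    {c : ℝ} (hc : c ≠ 0)
    (hrel : ∀ s ∈ I, form ρ (B (ν s)) n =
      (-signedCurvature ρ α ν s - c) * form ρ (B (α s - o)) n) :
    SatisfiesEulerLagrange ρ (-1 / c) I (signedCurvature ρ α ν) := by
  set κ := signedCurvature ρ α ν with hκ
  have hκs := h.contDiffOn_signedCurvature
  refine ⟨hκs.of_le (by norm_cast), fun s hs => ?_⟩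
  -- `G` is the length of the Killing field and `G₁` its derivative; `hG₁'` becomes the Gauss
  -- equation `G'' = -(κ² + c κ + ρ) G` once `hrel` is inserted.
  set G : ℝ → ℝ := fun r => form ρ (B (α r - o)) n with hG
  set G₁ : ℝ → ℝ := fun r => form ρ (B (deriv α r)) n with hG₁
  have hG' : ∀ r ∈ I, HasDerivAt G (G₁ r) r := fun r hr => by
    have h1 := hasDerivAt_form (ρ := ρ) (h.hasDerivAt_killing hr) (hasDerivAt_const r n)
    simpa only [form_zero_right, add_zero] using h1
  have hG₁' : ∀ r ∈ I, HasDerivAt G₁ (-ρ * G r + κ r * form ρ (B (ν r)) n) r := fun r hr => by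
    have h1 := hasDerivAt_form (ρ := ρ) (hasDerivAt_linearMap_comp B (h.hasDerivAt_deriv hr))
      (hasDerivAt_const r n)
    refine h1.congr_deriv ?_
    rw [form_zero_right, add_zero, h.deriv_deriv_eq hr, map_add, map_smul, map_smul,
      h.map_modelNormal hB hr, form_add_left, form_smul_left, form_smul_left]
    congr 1
    split_ifs with hρ
    · simp [hρ]
    · rw [form_smul_left, h.unit_n, mul_one]
  have hκ' : ∀ r ∈ I, HasDerivAt κ (deriv κ r) r := fun r hr =>
    hasDerivAt_of_contDiffOn h.isOpen hκs hr
  -- The Codazzi equation: `⟨B ν, n⟩ = (-κ - c) G` is differentiated on both sides, with `ν' = -κ T`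
  -- on the left.
  have hcod : ∀ r ∈ I, deriv κ r * G r = -c * G₁ r := fun r hr => by
    have h1 := hasDerivAt_form (ρ := ρ) (hasDerivAt_linearMap_comp B (h.hasDerivAt_normal hr))
      (hasDerivAt_const r n)
    rw [map_smul, form_smul_left, form_zero_right, add_zero] at h1
    have h2 := (((hκ' r hr).neg).sub_const c).mul (hG' r hr)
    have h3 : (fun r => form ρ (B (ν r)) n) =ᶠ[𝓝 r] fun r => (-κ r - c) * G r := by
      filter_upwards [h.isOpen.mem_nhds hr] with t ht using hrel t ht
    have h4 := (h1.congr_of_eventuallyEq h3.symm).unique h2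
    change -κ r * G₁ r = -deriv κ r * G r + (-κ r - c) * G₁ r at h4
    linarith
  have hGpos : ∀ r ∈ I, G r ≠ 0 := fun r hr => (h.killing_pos_n r hr).ne'
  -- By Codazzi, `exp (-κ / c)` has the same logarithmic derivative as `G`, so it inherits the
  -- linear second-order equation of `G`.
  have hE : ∀ r ∈ I, HasDerivAt (fun t => Real.exp (-1 / c * κ t))
      (G₁ r / G r * Real.exp (-1 / c * κ r)) r := fun r hr => by
    refine ((hκ' r hr).const_mul (-1 / c)).exp.congr_deriv ?_
    rw [mul_comm]
    congr 1
    rw [eq_div_iff (hGpos r hr), mul_assoc, hcod r hr]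
    field_simp
  have hE1 : deriv (fun t => Real.exp (-1 / c * κ t)) =ᶠ[𝓝 s]
      fun r => G₁ r / G r * Real.exp (-1 / c * κ r) := by
    filter_upwards [h.isOpen.mem_nhds hs] with r hr using (hE r hr).deriv
  have hE2 := (((hG₁' s hs).div (hG' s hs) (hGpos s hs)).mul (hE s hs)).congr_of_eventuallyEq hE1
  rw [hE2.deriv, hrel s hs]
  change ((-ρ * G s + κ s * ((-κ s - c) * G s)) * G s - G₁ s * G₁ s) / G s ^ 2 *
    Real.exp (-1 / c * κ s) + G₁ s / G s * (G₁ s / G s * Real.exp (-1 / c * κ s)) + _ = 0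
  have := hGpos s hs
  field_simp
  ring

end IsMeridianFrame

/-- A meridian has a smooth unit normal field in the totally geodesic surface containing it. -/
theorem IsMeridian.exists_frame (h : IsMeridian ρ B o I α) (hB : IsGenerator ρ φ B o)
    (hne : I.Nonempty) : ∃ n ν, IsMeridianFrame ρ B o I α n ν := by
  obtain ⟨n, hn, hX⟩ := h.exists_killing_direction hB hne
  have hn0 : ∀ s ∈ I, ∀ v, form ρ (B (α s - o)) v = 0 → form ρ n v = 0 := fun s hs v hv => by
    rw [(hX s hs).2, form_smul_left] at hv
    exact (mul_eq_zero.1 hv).resolve_left (hX s hs).1.ne'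
  have hTn : ∀ s ∈ I, form ρ (deriv α s) n = 0 := fun s hs => by
    rw [form_comm]; exact hn0 s hs _ (h.killing_orthogonal s hs)
  have hmn : ∀ s ∈ I, form ρ (modelNormal ρ (α s)) n = 0 := fun s hs => by
    rw [form_comm]
    exact hn0 s hs _ (by rw [form_comm]; exact h.killing_tangent s hs)
  refine ⟨n, fun s => crossScale ρ • cross ρ (modelNormal ρ (α s)) (deriv α s) n,
    { toIsMeridian := h
      unit_n := hn
      killing_pos_n := fun s hs => (hX s hs).1
      killing_eq_n := fun s hs => (hX s hs).2
      smooth_normal := ?_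
      unit_normal := fun s hs => form_crossScale_smul_cross (h.mem s hs) (h.tangent s hs)
        (hmn s hs) (hTn s hs) (h.unit_speed s hs) hn
      normal_model := fun s _ => ?_
      normal_deriv := fun s _ => ?_
      normal_n := fun s _ => ?_ }⟩
  · exact (contDiffOn_const (c := crossScale ρ)).smul (contDiffOn_cross h.contDiffOn_modelNormal
      (contDiffOn_deriv_of_isOpen h.isOpen h.smooth) contDiffOn_const)
  · rw [form_comm, form_smul_left, form_cross_fst, mul_zero]
  · rw [form_comm, form_smul_left, form_cross_snd, mul_zero]
  · rw [form_comm, form_smul_left, form_cross_trd, mul_zero]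

end Meridian

/-! ### The principal curvatures along a profile curve. -/

section Profile

open Filter Topology

variable {N : Type*} [TopologicalSpace N] [ChartedSpace (EuclideanSpace ℝ (Fin 2)) N]
  [IsManifold (𝓡 2) ∞ N] {ρ : ℝ} {Φ : N → V4} {φ : ℝ → V4 →ᵃ[ℝ] V4} {B : V4 →ₗ[ℝ] V4} {o : V4}
  {τ : ℝ → N → N} {I : Set ℝ} {γ : ℝ → N}

omit [IsManifold (𝓡 2) ∞ N] in
theorem killing_mem_tangentRange (hΦ : IsImmersedSurface ρ Φ) (hφ : IsRotationGroup ρ φ)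
    (hB : IsGenerator ρ φ B o) (hτ0 : ∀ p, τ 0 p = p)
    (hτ : ContMDiff (𝓘(ℝ, ℝ).prod (𝓡 2)) (𝓡 2) ∞ (fun q : ℝ × N => τ q.1 q.2))
    (heq : ∀ t p, Φ (τ t p) = φ t (Φ p)) (p : N) :
    B (Φ p - o) ∈ tangentRange Φ p ∧ HasDerivAt (fun t => Φ (τ t p)) (B (Φ p - o)) 0 := by
  have h1 : HasDerivAt (fun t => Φ (τ t p)) (B (Φ p - o)) 0 := by
    simp only [heq]
    simpa only [IsGenerator.linear_zero hφ] using hB.hasDerivAt_orbit (Φ p) 0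
  obtain ⟨v, hv, hvd⟩ := hasDerivAt_comp_curve (hΦ.smooth.mdifferentiableAt (by simp))
    ((contMDiff_action_left hτ p).mdifferentiableAt (by simp)) (hτ0 p)
  rw [h1.unique hvd]
  exact ⟨hv, hvd⟩

omit [IsManifold (𝓡 2) ∞ N] in
theorem IsProfileCurve.contMDiffAt (hγ : IsProfileCurve ρ Φ φ I γ) {s : ℝ} (hs : s ∈ I) :
    ContMDiffAt 𝓘(ℝ, ℝ) (𝓡 2) ∞ γ s :=
  hγ.smooth.contMDiffAt (hγ.isOpen.mem_nhds hs)

omit [IsManifold (𝓡 2) ∞ N] in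
theorem IsProfileCurve.deriv_mem_tangentRange (hγ : IsProfileCurve ρ Φ φ I γ)
    (hΦ : IsImmersedSurface ρ Φ) {s : ℝ} (hs : s ∈ I) :
    deriv (fun r => Φ (γ r)) s ∈ tangentRange Φ (γ s) := by
  obtain ⟨v, hv, hvd⟩ := hasDerivAt_comp_curve (hΦ.smooth.mdifferentiableAt (by simp))
    ((hγ.contMDiffAt hs).mdifferentiableAt (by simp)) rfl
  rwa [hvd.deriv]

theorem IsProfileCurve.isMeridian (hγ : IsProfileCurve ρ Φ φ I γ) (hΦ : IsImmersedSurface ρ Φ)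
    (hφ : IsRotationGroup ρ φ) (hB : IsGenerator ρ φ B o) (hτ0 : ∀ p, τ 0 p = p)
    (hτ : ContMDiff (𝓘(ℝ, ℝ).prod (𝓡 2)) (𝓡 2) ∞ (fun q : ℝ × N => τ q.1 q.2))
    (heq : ∀ t p, Φ (τ t p) = φ t (Φ p)) (hne : ∀ p, B (Φ p - o) ≠ 0) :
    IsMeridian ρ B o I (fun r => Φ (γ r)) where
  isOpen := hγ.isOpen
  ordConnected := hγ.ordConnected
  smooth := by
    rw [← contMDiffOn_iff_contDiffOn]
    exact hΦ.smooth.comp_contMDiffOn hγ.smooth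
  mem s _ := hΦ.mem _
  unit_speed := hγ.unit_speed
  tangent s hs := modelNormal_orthogonal_tangentRange hΦ (hγ.deriv_mem_tangentRange hΦ hs)
  killing_tangent s _ := modelNormal_orthogonal_tangentRange hΦ
    (killing_mem_tangentRange hΦ hφ hB hτ0 hτ heq _).1
  killing_orthogonal s hs := by
    rw [form_comm, ← hB.killing_eq hφ]
    exact hγ.orthogonal s hs
  killing_ne_zero s _ := hne _

-- The tangent plane has dimension at most two, so it is spanned by the orthogonal nonzero vectors
-- `T` and `X`, both normal to `ν`.
omit [IsManifold (𝓡 2) ∞ N] in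
theorem normal_orthogonal_tangentRange {n : V4} {ν : ℝ → V4} (hγ : IsProfileCurve ρ Φ φ I γ)
    (hΦ : IsImmersedSurface ρ Φ) (hφ : IsRotationGroup ρ φ) (hB : IsGenerator ρ φ B o)
    (hτ0 : ∀ p, τ 0 p = p)
    (hτ : ContMDiff (𝓘(ℝ, ℝ).prod (𝓡 2)) (𝓡 2) ∞ (fun q : ℝ × N => τ q.1 q.2))
    (heq : ∀ t p, Φ (τ t p) = φ t (Φ p))
    (h : IsMeridianFrame ρ B o I (fun r => Φ (γ r)) n ν) {s : ℝ} (hs : s ∈ I) {w : V4}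
    (hw : w ∈ tangentRange Φ (γ s)) : form ρ w (ν s) = 0 := by
  set T := deriv (fun r => Φ (γ r)) s
  set X := B (Φ (γ s) - o)
  have hT : T ∈ tangentRange Φ (γ s) := hγ.deriv_mem_tangentRange hΦ hs
  have hX : X ∈ tangentRange Φ (γ s) := (killing_mem_tangentRange hΦ hφ hB hτ0 hτ heq _).1
  have hTν : form ρ T (ν s) = 0 := h.normal_deriv s hs
  have hXν : form ρ X (ν s) = 0 := by
    rw [show X = _ from h.killing_eq_n s hs, form_smul_left, h.normal_n s hs, mul_zero]
  have hTT : form ρ T T = 1 := h.unit_speed s hs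
  have hXX : form ρ X X ≠ 0 := (h.killing_pos hs).ne'
  have hXT : form ρ X T = 0 := h.killing_orthogonal s hs
  have hli : LinearIndependent ℝ ![(⟨T, hT⟩ : tangentRange Φ (γ s)), ⟨X, hX⟩] := by
    rw [LinearIndependent.pair_iff]
    intro a b hab
    have hab' : a • T + b • X = 0 := congrArg Subtype.val hab
    have h1 := congrArg (fun v => form ρ v T) hab'
    have h2 := congrArg (fun v => form ρ v X) hab'
    simp only [form_add_left, form_smul_left, form_zero_left, hTT, hXT, form_comm ρ T X] at h1 h2
    refine ⟨by linarith, ?_⟩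
    have : b * form ρ X X = 0 := by linarith
    exact (mul_eq_zero.1 this).resolve_right hXX
  have hspan := hli.span_eq_top_of_card_eq_finrank' (by
    refine le_antisymm ?_ ?_
    · exact hli.fintype_card_le_finrank
    · simpa using finrank_tangentRange_le Φ (γ s))
  have hmem : (⟨w, hw⟩ : tangentRange Φ (γ s)) ∈
      Submodule.span ℝ (Set.range ![(⟨T, hT⟩ : tangentRange Φ (γ s)), ⟨X, hX⟩]) := by
    rw [hspan]; trivial
  rw [Matrix.range_cons, Matrix.range_cons, Matrix.range_empty, Set.union_empty,
    Set.singleton_union, Submodule.mem_span_pair] at hmem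
  obtain ⟨a, b, hab⟩ := hmem
  have hw' : a • T + b • X = w := congrArg Subtype.val hab
  rw [← hw', form_add_left, form_smul_left, form_smul_left, hTν, hXν]
  ring

/-- The principal curvatures of a rotational surface along a profile curve. -/
theorem curvatures_along_profile {n : V4} {ν : ℝ → V4} (hγ : IsProfileCurve ρ Φ φ I γ)
    (hΦ : IsImmersedSurface ρ Φ) (hφ : IsRotationGroup ρ φ) (hB : IsGenerator ρ φ B o)
    (hτ0 : ∀ p, τ 0 p = p) (hτadd : ∀ s t p, τ (s + t) p = τ s (τ t p))
    (hτ : ContMDiff (𝓘(ℝ, ℝ).prod (𝓡 2)) (𝓡 2) ∞ (fun q : ℝ × N => τ q.1 q.2))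
    (heq : ∀ t p, Φ (τ t p) = φ t (Φ p))
    (h : IsMeridianFrame ρ B o I (fun r => Φ (γ r)) n ν) {s : ℝ} (hs : s ∈ I) :
    IsUnitNormal ρ Φ (γ s) (-ν s) ∧
      principalCurvatures ρ Φ (γ s) (-ν s) = {-signedCurvature ρ (fun r => Φ (γ r)) ν s,
        form ρ (B (ν s)) n / form ρ (B (Φ (γ s) - o)) n} ∧
      skewCurvature ρ Φ (γ s) (-ν s) = |-signedCurvature ρ (fun r => Φ (γ r)) ν s -
        form ρ (B (ν s)) n / form ρ (B (Φ (γ s) - o)) n| := by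
  have hnorm : ∀ r ∈ I, ∀ w ∈ tangentRange Φ (γ r), form ρ w (-ν r) = 0 := fun r hr w hw => by
    rw [form_neg_right, normal_orthogonal_tangentRange hγ hΦ hφ hB hτ0 hτ heq h hr hw, neg_zero]
  have hunit : IsUnitNormal ρ Φ (γ s) (-ν s) := by
    refine (isUnitNormal_iff hΦ.smooth).2 ⟨?_, ?_, hnorm s hs⟩
    · rw [form_neg_left, form_neg_right, neg_neg, h.unit_normal s hs]
    · rw [isTangent_iff, form_neg_right, h.normal_model s hs, neg_zero]
  refine ⟨hunit, ?_⟩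
  obtain ⟨a, ha, ha'⟩ := secondForm_along_curve (ρ := ρ) hΦ.smooth
    ((hγ.contMDiffAt hs).mdifferentiableAt (by simp)) rfl (h.hasDerivAt hs)
    (h.hasDerivAt_normal hs).neg (by
      filter_upwards [hγ.isOpen.mem_nhds hs] with r hr using hnorm r hr)
  -- Along the orbit the normal field is `-ν s` transported by the group. It stays normal since a
  -- tangent vector at `τ t (γ s)` can be pulled back by `φ (-t)`.
  have hη : HasDerivAt (fun t => (φ t).linear (-ν s)) (B (-ν s)) 0 := by
    simpa only [IsGenerator.linear_zero hφ] using hB.hasDerivAt_linear (-ν s) 0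
  obtain ⟨b, hb, hb'⟩ := secondForm_along_curve (ρ := ρ) hΦ.smooth
    ((contMDiff_action_left hτ (γ s)).mdifferentiableAt (by simp)) (hτ0 (γ s))
    (killing_mem_tangentRange hΦ hφ hB hτ0 hτ heq (γ s)).2 hη (by
      refine Eventually.of_forall fun t w hw => ?_
      have h1 := linear_mem_tangentRange hΦ.smooth hτ heq (-t) hw
      rw [← hτadd, neg_add_cancel, hτ0] at h1
      have h2 := hnorm s hs _ h1
      rw [← hφ.preserves_form t, linear_apply (φ t) ((φ (-t)).linear w)] at h2
      have h3 : φ t ((φ (-t)).linear w) - φ t 0 = w := by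
        rw [← linear_apply]
        have h4 : ∀ v, (φ t).linear ((φ (-t)).linear v) = v := fun v => by
          have h5 := hφ.map_add t (-t) (v + o)
          rw [add_neg_cancel, hφ.map_zero, hB.apply_eq t, hB.apply_eq (-t)] at h5
          simpa [add_comm] using h5.symm
        exact h4 w
      rwa [h3] at h2)
  rw [IsGenerator.linear_zero hφ] at hb'
  have hX := h.killing_eq_n s hs
  have hXn := (h.killing_pos_n s hs).ne'
  refine curvatures_of_principal_directions ha hb ?_ ?_ ?_ (fun j => ?_) (fun j => ?_)
  · rw [h.unit_speed s hs]; exact one_ne_zero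
  · exact (h.killing_pos hs).ne'
  · rw [form_comm]; exact h.killing_orthogonal s hs
  · refine (ha' j).trans ?_
    rw [form_neg_right, form_smul_right, form_comm]
    ring
  · refine (hb' j).trans ?_
    rw [map_neg, form_neg_right, h.map_normal hB hs, hX, form_smul_right, form_smul_left,
      form_smul_left, form_smul_left, h.unit_n, form_comm ρ n]
    field_simp

end Profile

/-! ### Choice of orientation and conclusion. -/

theorem isGeodesicSurfaceData_single (ρ : ℝ) : IsGeodesicSurfaceData ρ (Pi.single 0 1) 0 :=
  ⟨by simp [form], fun _ => by simp, fun _ => rfl⟩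

/-- A continuous function of constant positive absolute value on an interval has constant sign. -/
theorem eq_or_eq_neg_of_abs_eq {I : Set ℝ} {f : ℝ → ℝ} {c : ℝ} (hI : I.OrdConnected)
    (hf : ContinuousOn f I) (hc : 0 < c) (h : ∀ s ∈ I, |f s| = c) :
    (∀ s ∈ I, f s = c) ∨ ∀ s ∈ I, f s = -c := by
  have := hI.isPreconnected.eq_or_eq_neg_of_sq_eq hf continuousOn_const
    (g := fun _ => c) (fun s hs => by
      simp only [Pi.pow_apply]
      rw [← sq_abs, h s hs]) (fun _ => hc.ne')
  exact this

end SkewRot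

theorem theorem1 (ρ c : ℝ) (hc : 0 < c)
    {N : Type*} [TopologicalSpace N] [ChartedSpace (EuclideanSpace ℝ (Fin 2)) N]
    [IsManifold (𝓡 2) ∞ N]
    (Φ : N → SkewRot.V4) (hΦ : SkewRot.IsImmersedSurface ρ Φ)
    (φ : ℝ → SkewRot.V4 →ᵃ[ℝ] SkewRot.V4) (hφ : SkewRot.IsRotationGroup ρ φ)
    (hinv : SkewRot.IsInvariantUnder Φ φ)
    (hskew : SkewRot.HasConstantSkewCurvature ρ Φ c)
    (hiso : ¬ SkewRot.IsIsoparametric ρ Φ)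
    (I : Set ℝ) (γ : ℝ → N) (hγ : SkewRot.IsProfileCurve ρ Φ φ I γ) :
    ∃ (n : SkewRot.V4) (d : ℝ), SkewRot.IsGeodesicSurfaceData ρ n d ∧
      (∀ s ∈ I, Φ (γ s) ∈ SkewRot.geodesicSurface ρ n d) ∧
      ∃ ν : ℝ → SkewRot.V4,
        SkewRot.IsUnitNormalAlong ρ n I (fun r => Φ (γ r)) ν ∧
        (∀ s ∈ I, SkewRot.IsUnitNormal ρ Φ (γ s) (-ν s) ∧
          SkewRot.principalCurvatures ρ Φ (γ s) (-ν s) =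
            {-SkewRot.signedCurvature ρ (fun r => Φ (γ r)) ν s,
              -SkewRot.signedCurvature ρ (fun r => Φ (γ r)) ν s - c}) ∧
        SkewRot.SatisfiesEulerLagrange ρ (-1 / c) I
          (SkewRot.signedCurvature ρ (fun r => Φ (γ r)) ν) := by
  open SkewRot in
  -- An empty interval singles out no direction `n`, so an arbitrary totally geodesic surface is
  -- supplied.
  rcases I.eq_empty_or_nonempty with rfl | hne
  · exact ⟨Pi.single 0 1, 0, isGeodesicSurfaceData_single ρ, by simp, 0,
      ⟨contDiffOn_empty, by simp, by simp, by simp, by simp⟩, by simp, contDiffOn_empty, by simp⟩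
  obtain ⟨τ, hτ0, hτadd, hτ, heq⟩ := hinv
  obtain ⟨B, o, hB⟩ := hφ.exists_isGenerator
  have hmer : IsMeridian ρ B o I (fun r => Φ (γ r)) := hγ.isMeridian hΦ hφ hB hτ0 hτ heq
    (killing_ne_zero_of_skewCurvature hΦ hφ hB hτ0 hτ heq hc hskew)
  obtain ⟨n, ν, hrel, hframe⟩ : ∃ n ν, (∀ s ∈ I, form ρ (B (ν s)) n =
      (-signedCurvature ρ (fun r => Φ (γ r)) ν s - c) * form ρ (B (Φ (γ s) - o)) n) ∧
      IsMeridianFrame ρ B o I (fun r => Φ (γ r)) n ν := by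
    obtain ⟨n, ν, hframe⟩ := hmer.exists_frame hB hne
    have habs : ∀ s ∈ I, |-signedCurvature ρ (fun r => Φ (γ r)) ν s -
        form ρ (B (ν s)) n / form ρ (B (Φ (γ s) - o)) n| = c := fun s hs => by
      obtain ⟨h1, -, h2⟩ := curvatures_along_profile hγ hΦ hφ hB hτ0 hτadd hτ heq hframe hs
      rw [← h2, hskew _ _ h1]
    have hcont : ContinuousOn (fun s => -signedCurvature ρ (fun r => Φ (γ r)) ν s -
        form ρ (B (ν s)) n / form ρ (B (Φ (γ s) - o)) n) I := by
      refine (hframe.contDiffOn_signedCurvature.continuousOn.neg).sub (ContinuousOn.div ?_ ?_ ?_)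
      · exact fun s hs => (hasDerivAt_form (hasDerivAt_linearMap_comp B
          (hframe.hasDerivAt_normal hs)) (hasDerivAt_const s n)).continuousAt.continuousWithinAt
      · exact fun s hs => (hasDerivAt_form (hframe.hasDerivAt_killing hs)
          (hasDerivAt_const s n)).continuousAt.continuousWithinAt
      · exact fun s hs => (hframe.killing_pos_n s hs).ne'
    rcases eq_or_eq_neg_of_abs_eq hγ.ordConnected hcont hc habs with h | h
    · refine ⟨n, ν, fun s hs => ?_, hframe⟩
      have h1 := (hframe.killing_pos_n s hs).ne'
      have h2 := h s hs
      rw [← div_eq_iff h1]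
      linarith
    -- Replacing `ν` by `-ν` changes the sign of both principal curvatures, hence of their
    -- difference.
    · refine ⟨n, -ν, fun s hs => ?_, hframe.neg⟩
      have h1 := (hframe.killing_pos_n s hs).ne'
      have h2 := h s hs
      rw [← div_eq_iff h1, Pi.neg_apply, map_neg, form_neg_left, neg_div, signedCurvature,
        Pi.neg_apply, form_neg_right]
      rw [signedCurvature] at h2
      linarith
  obtain ⟨s₀, hs₀⟩ := hne
  have hn3 : ρ = 0 → n 3 = 0 := fun hρ =>
    (isTangent_iff.2 (hframe.form_model_n hs₀)).1 hρ
  have hdconst : ∀ s ∈ I, form ρ n (Φ (γ s)) = form ρ n (Φ (γ s₀)) := fun s hs => by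
    have hd : ∀ r ∈ I, HasDerivAt (fun t => form ρ n (Φ (γ t))) 0 r := fun r hr => by
      refine (hasDerivAt_form (hasDerivAt_const r n) (hframe.hasDerivAt hr)).congr_deriv ?_
      rw [form_zero_left, zero_add, hframe.form_n_deriv hr]
    exact hγ.isOpen.is_const_of_deriv_eq_zero hγ.ordConnected.isPreconnected
      (fun r hr => (hd r hr).differentiableAt.differentiableWithinAt)
      (fun r hr => (hd r hr).deriv) hs hs₀
  refine ⟨n, form ρ n (Φ (γ s₀)), ⟨hframe.unit_n, hn3, fun hρ => ?_⟩,
    fun s hs => ⟨hΦ.mem _, hdconst s hs⟩, ν,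
    ⟨hframe.smooth_normal, hframe.unit_normal, fun s hs => isTangent_iff.2 (hframe.normal_model s hs),
      hframe.normal_n, hframe.normal_deriv⟩, fun s hs => ?_,
    hframe.satisfiesEulerLagrange hB hc.ne' hrel⟩
  -- For `ρ ≠ 0` the Killing direction `n` is tangent to the space form, that is, orthogonal to the
  -- position vector, so the offset is `0`.
  · rw [form_comm]
    exact (isTangent_iff.2 (hframe.form_model_n hs₀)).2 hρ
  · obtain ⟨h1, h2, -⟩ := curvatures_along_profile hγ hΦ hφ hB hτ0 hτadd hτ heq hframe hs
    refine ⟨h1, ?_⟩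
    rw [h2, hrel s hs, mul_div_cancel_right₀ _ (hframe.killing_pos_n s hs).ne']
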